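/- Let $C(U_0(2))$ be the universal enveloping $C^*$-algebra of the unital $*$-algebra generated by $a,c,v$ with the relations $$av=va,\quad cv=vc,\quad cc^*=c^*c,\quad ac=ac^*=0,\quad vv^*=v^*v=1,\quad aa^*=1=a^*a+c^*c,$$ and let $\Delta:C(U_0(2))\to C(U_0(2))\otimes C(U_0(2))$ (spatial tensor product) be the unital $*$-homomorphism with $$\Delta(a)=a\otimes a,\qquad \Delta(c)=c\otimes a+a^*v^*\otimes c,\qquad \Delta(v)=v\otimes v .$$ Let $C(SU_0(2))$ be the universal enveloping $C^*$-algebra of the unital $*$-algebra generated by $\alpha,\gamma$ with the relations $$\alpha\gamma=\alpha\gamma^*=0,\quad \gamma^*\gamma=\gamma\gamma^*,\quad \gamma^*\gamma+\alpha^*\alpha=1,\quad \alpha\alpha^*-\alpha^*\alpha=\gamma^*\gamma,$$ with the coproduct $\Delta(\alpha)=\alpha\otimes\alpha$, $\Delta(\gamma)=\gamma\otimes\alpha+\alpha^*\otimes\gamma$. A state $\phi$ is called idempotent if $(\phi\otimes\phi)\circ\Delta=\phi$. For $k<0$ write $c^{k}=(c^*)^{-k}$, $\gamma^{k}=(\gamma^*)^{-k}$,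 $v^{k}=(v^*)^{-k}$. Let $\pi_{\mathbb T^2}:C(U_0(2))\to C(\mathbb T^2)$ be the unital $*$-homomorphism with $a\mapsto w_1$, $c\mapsto 0$, $v\mapsto w_2$, where $w_1,w_2$ are the coordinate functions on $\mathbb T^2$. Identify $C(U_0(2))$ with $C(SU_0(2))\otimes C(U(1))$ by $a\mapsto\alpha\otimes 1$, $c\mapsto\gamma\otimes 1$, $v\mapsto 1\otimes w$, where $w$ is the coordinate function on $U(1)$. For $m\in\mathbb N=\{1,2,\dots\}$ let $\phi_m$ be the state on $C(U(1))$ given by the Haar measure of the group $\mathbb Z_m$ of $m$-th roots of unity, and let $\phi_\infty$ be the state given by the Haar measure of $U(1)$. (Haar measures have total mass one.) Theorem. For every $n\in\mathbb Z_+=\{0,1,2,\dots\}$ there is exactly one state $\psi_n$ on $C(SU_0(2))$ such that, for all $r,s\in\mathbb Z_+$ and $k\in\mathbb Z$, $$\psi_n\big((\alpha^*)^r\gamma^k\alpha^s\big)=\begin{cases}1&\text{if } k=0 \text{ and } r=s\le n,\\ 0&\text{otherwise,}\end{cases}$$ and $\psi_n$ is idempotent. The idempotent states on $U_0(2)$ are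 exactly the following. 1. The states $\phi_\rho=\int_{\mathbb T^2}\pi_{\mathbb T^2}(\,\cdot\,)\,d\rho$, where $\rho$ is the Haar measure of $\mathbb T^2$ or of one of its closed subgroups. They satisfy, for all $r,s\in\mathbb Z_+$ and $k,\ell\in\mathbb Z$, $$\phi_\rho\big((a^*)^rc^ka^sv^\ell\big)=\delta_{0k}\int_{\mathbb T^2}w_1^{s-r}w_2^{\ell}\,d\rho(w_1,w_2),$$ and for the trivial subgroup $\phi_\rho$ is the counit of $U_0(2)$, that is, the character with $a,v\mapsto 1$ and $c\mapsto 0$. 2. The states $\Psi_{n,m}=\psi_n\otimes\phi_m$, $n\in\mathbb Z_+$, $m\in\mathbb N\cup\{\infty\}$. -/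

import Mathlib

noncomputable section

open scoped TensorProduct ComplexOrder

namespace IdemU02

/-! ### C*-seminorms and the associated C*-algebra -/

theorem seminorm_dist_self {P : Type*} [Ring P] [Algebra ℂ P] (p : Seminorm ℂ P) (x : P) :
    p (-x + x) = 0 := by simp

theorem seminorm_dist_comm {P : Type*} [Ring P] [Algebra ℂ P] (p : Seminorm ℂ P) (x y : P) :
    p (-x + y) = p (-y + x) := by
  rw [← map_neg_eq_map p]; congr 1; abel

theorem seminorm_dist_triangle {P : Type*} [Ring P] [Algebra ℂ P] (p : Seminorm ℂ P)
    (x y z : P) :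
    p (-x + z) ≤ p (-x + y) + p (-y + z) := by
  have h := map_add_le_add p (-x + y) (-y + z)
  rwa [show -x + y + (-y + z) = -x + z by abel] at h

section CStarSeminorm

variable {P : Type*} [Ring P] [Algebra ℂ P] [StarRing P]

/-- A C*-seminorm on a unital complex `*`-algebra. -/
structure IsCStarSeminorm (p : Seminorm ℂ P) : Prop where
  mul_le : ∀ x y, p (x * y) ≤ p x * p y
  star_mul_self : ∀ x, p (star x * x) = p x ^ 2

theorem IsCStarSeminorm.star_le {p : Seminorm ℂ P} (hp : IsCStarSeminorm p) (x : P) :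
    p (star x) ≤ p x := by
  have h : ∀ y : P, p y ≤ p (star y) := by
    intro y
    rcases (apply_nonneg p y).eq_or_lt with h0 | h0
    · rw [← h0]; exact apply_nonneg p _
    · have h1 := hp.star_mul_self y
      have h2 := hp.mul_le (star y) y
      rw [h1, sq] at h2
      exact le_of_mul_le_mul_right h2 h0
  simpa using h (star x)

theorem isCStarSeminorm_sSup {S : Set (Seminorm ℂ P)} (hS : ∀ p ∈ S, IsCStarSeminorm p)
    (hb : BddAbove S) : IsCStarSeminorm (sSup S) := by
  have hbx : ∀ x, BddAbove (Set.range fun p : S => (p : Seminorm ℂ P) x) := by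
    intro x
    obtain ⟨q, hq⟩ := hb
    exact ⟨q x, by rintro _ ⟨p, rfl⟩; exact hq p.2 x⟩
  have hle : ∀ x, ∀ p ∈ S, p x ≤ sSup S x := fun x p hp => by
    rw [Seminorm.sSup_apply hb]; exact le_ciSup (hbx x) ⟨p, hp⟩
  constructor
  · intro x y
    rw [Seminorm.sSup_apply hb]
    refine Real.iSup_le (fun p => ?_) (mul_nonneg (apply_nonneg _ _) (apply_nonneg _ _))
    exact ((hS p p.2).mul_le x y).trans
      (mul_le_mul (hle x p p.2) (hle y p p.2) (apply_nonneg _ _) (apply_nonneg _ _))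
  · intro x
    apply le_antisymm
    · rw [Seminorm.sSup_apply hb]
      refine Real.iSup_le (fun p => ?_) (sq_nonneg _)
      rw [(hS p p.2).star_mul_self]
      exact pow_le_pow_left₀ (apply_nonneg _ _) (hle x p p.2) 2
    · have h : sSup S x ≤ Real.sqrt (sSup S (star x * x)) := by
        rw [Seminorm.sSup_apply hb (x := x)]
        refine Real.iSup_le (fun p => Real.le_sqrt_of_sq_le ?_) (Real.sqrt_nonneg _)
        rw [← (hS p p.2).star_mul_self]
        exact hle _ p p.2
      calc sSup S x ^ 2 ≤ Real.sqrt (sSup S (star x * x)) ^ 2 :=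
            pow_le_pow_left₀ (apply_nonneg _ _) h 2
        _ = _ := Real.sq_sqrt (apply_nonneg _ _)

/-- The `*`-algebra `P`, regarded as a seminormed algebra by means of the C*-seminorm `p`. -/
@[nolint unusedArguments]
def Seminormed (p : Seminorm ℂ P) (_ : IsCStarSeminorm p) : Type _ := P

variable {p : Seminorm ℂ P} {hp : IsCStarSeminorm p}

instance : Ring (Seminormed p hp) := inferInstanceAs (Ring P)
instance : Algebra ℂ (Seminormed p hp) := inferInstanceAs (Algebra ℂ P)
instance : StarRing (Seminormed p hp) := inferInstanceAs (StarRing P)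
instance [StarModule ℂ P] : StarModule ℂ (Seminormed p hp) := inferInstanceAs (StarModule ℂ P)

/-- The identity `P → Seminormed p hp`. -/
def toSeminormed (p : Seminorm ℂ P) (hp : IsCStarSeminorm p) : P →⋆ₐ[ℂ] Seminormed p hp :=
  StarAlgHom.id ℂ P

instance : SeminormedRing (Seminormed p hp) where
  __ := (inferInstance : Ring (Seminormed p hp))
  norm := p
  dist x y := p (-x + y)
  dist_self x := seminorm_dist_self p x
  dist_comm x y := seminorm_dist_comm p x y
  dist_triangle x y z := seminorm_dist_triangle p x y z
  dist_eq _ _ := rfl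
  norm_mul_le := hp.mul_le

theorem norm_toSeminormed (x : P) : ‖toSeminormed p hp x‖ = p x := rfl

instance : NormedAlgebra ℂ (Seminormed p hp) where
  __ := (inferInstance : Algebra ℂ (Seminormed p hp))
  norm_smul_le r x := (map_smul_eq_mul p r x).le

instance : NormedStarGroup (Seminormed p hp) where
  norm_star_le := hp.star_le

variable (p hp) in
/-- The C*-algebra obtained from `P` by separation and completion with respect to `p`. -/
abbrev CStarCompletion : Type _ := UniformSpace.Completion (Seminormed p hp)

namespace CStarCompletion

open UniformSpace Completion

theorem uniformContinuous_star_seminormed :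
    UniformContinuous (star : Seminormed p hp → Seminormed p hp) :=
  (AddMonoidHomClass.isometry_of_norm starAddEquiv norm_star).uniformContinuous

instance : Star (CStarCompletion p hp) where
  star := Completion.map star

theorem coe_star (x : Seminormed p hp) :
    ((star x : Seminormed p hp) : CStarCompletion p hp) = star (x : CStarCompletion p hp) :=
  (Completion.map_coe uniformContinuous_star_seminormed x).symm

theorem continuous_star' : Continuous (star : CStarCompletion p hp → CStarCompletion p hp) :=
  Completion.continuous_map

instance : StarRing (CStarCompletion p hp) where
  star_involutive x := by
    induction x using Completion.induction_on with
    | hp => exact isClosed_eq (continuous_star'.comp continuous_star') continuous_id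
    | ih x => rw [← coe_star, ← coe_star, star_star]
  star_mul x y := by
    induction x, y using Completion.induction_on₂ with
    | hp =>
      exact isClosed_eq (continuous_star'.comp continuous_mul)
        ((continuous_star'.comp continuous_snd).mul (continuous_star'.comp continuous_fst))
    | ih x y => simp only [← coe_star, ← Completion.coe_mul, star_mul]
  star_add x y := by
    induction x, y using Completion.induction_on₂ with
    | hp =>
      exact isClosed_eq (continuous_star'.comp continuous_add)
        ((continuous_star'.comp continuous_fst).add (continuous_star'.comp continuous_snd))
    | ih x y => simp only [← coe_star, ← Completion.coe_add, star_add]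

theorem norm_coe_sq (x : Seminormed p hp) : ‖star x * x‖ = ‖x‖ * ‖x‖ := by
  rw [← sq]; exact hp.star_mul_self x

instance : CStarRing (CStarCompletion p hp) where
  norm_mul_self_le x := by
    induction x using Completion.induction_on with
    | hp =>
      exact isClosed_le (continuous_norm.mul continuous_norm)
        (continuous_norm.comp (continuous_star'.mul continuous_id))
    | ih x =>
      rw [← coe_star, ← Completion.coe_mul, Completion.norm_coe, Completion.norm_coe, norm_coe_sq]

instance [StarModule ℂ P] : StarModule ℂ (CStarCompletion p hp) where
  star_smul r x := by
    induction x using Completion.induction_on with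
    | hp =>
      exact isClosed_eq (continuous_star'.comp (continuous_const_smul r))
        (continuous_star'.const_smul (star r))
    | ih x => simp only [← coe_star, ← Completion.coe_smul, star_smul]

instance instCStarAlgebra [StarModule ℂ P] : CStarAlgebra (CStarCompletion p hp) where
  norm_smul_le := norm_smul_le

variable (p hp) in
/-- The canonical `*`-homomorphism, with dense range, from `P` to its completion. -/
def of [StarModule ℂ P] : P →⋆ₐ[ℂ] CStarCompletion p hp where
  toFun x := (toSeminormed p hp x : CStarCompletion p hp)
  map_one' := rfl
  map_mul' x y := by rw [map_mul, Completion.coe_mul]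
  map_zero' := rfl
  map_add' x y := by rw [map_add, Completion.coe_add]
  commutes' r := rfl
  map_star' x := by rw [map_star, coe_star]

theorem norm_of [StarModule ℂ P] (x : P) : ‖of p hp x‖ = p x :=
  Completion.norm_coe (toSeminormed p hp x)

theorem denseRange_of [StarModule ℂ P] : DenseRange (of p hp) :=
  Completion.denseRange_coe (α := Seminormed p hp)

variable (p hp) in
/-- The `*`-homomorphism `f`, regarded as a ring homomorphism on the seminormed algebra. -/
def seminormedHom {B : Type*} [CStarAlgebra B] (f : P →⋆ₐ[ℂ] B) : Seminormed p hp →+* B :=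
  RingHomClass.toRingHom f

theorem continuous_seminormedHom {B : Type*} [CStarAlgebra B] (f : P →⋆ₐ[ℂ] B)
    (hf : ∀ x, ‖f x‖ ≤ p x) : Continuous (seminormedHom p hp f) :=
  AddMonoidHomClass.continuous_of_bound _ 1 (fun x => by rw [one_mul]; exact hf x)

/-- A `*`-homomorphism `f` with `‖f x‖ ≤ p x` extends to the completion. -/
def lift [StarModule ℂ P] {B : Type*} [CStarAlgebra B] (f : P →⋆ₐ[ℂ] B)
    (hf : ∀ x, ‖f x‖ ≤ p x) : CStarCompletion p hp →⋆ₐ[ℂ] B :=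
  { Completion.extensionHom (seminormedHom p hp f) (continuous_seminormedHom f hf) with
    commutes' := fun r =>
      (Completion.extensionHom_coe (seminormedHom p hp f) (continuous_seminormedHom f hf)
        (algebraMap ℂ (Seminormed p hp) r)).trans (AlgHomClass.commutes f r)
    map_star' := fun x => by
      have hc : Continuous (Completion.extensionHom (seminormedHom p hp f)
        (continuous_seminormedHom f hf)) := Completion.continuous_extension
      change Completion.extensionHom (seminormedHom p hp f) (continuous_seminormedHom f hf)
          (star x) =
        star (Completion.extensionHom (seminormedHom p hp f) (continuous_seminormedHom f hf) x)
      induction x using Completion.induction_on with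
      | hp => exact isClosed_eq (hc.comp continuous_star') hc.star
      | ih x =>
        rw [← coe_star, Completion.extensionHom_coe, Completion.extensionHom_coe]
        exact map_star f x }

theorem lift_of [StarModule ℂ P] {B : Type*} [CStarAlgebra B] (f : P →⋆ₐ[ℂ] B)
    (hf : ∀ x, ‖f x‖ ≤ p x) (x : P) : lift (hp := hp) f hf (of p hp x) = f x :=
  Completion.extensionHom_coe (seminormedHom p hp f)
    (continuous_seminormedHom f hf) (toSeminormed p hp x)

end CStarCompletion

end CStarSeminorm
end IdemU02

namespace IdemU02

/-! ### The free `*`-algebra and C*-algebras given by generators and relations -/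

/-- The free unital complex `*`-algebra on `X`: the monoid algebra of the words in the letters
`(x, true)`, standing for `x`, and `(x, false)`, standing for `star x`. -/
def FreeStarAlgebra (X : Type) : Type := MonoidAlgebra ℂ (FreeMonoid (X × Bool))

namespace FreeStarAlgebra

variable {X : Type}

instance : Ring (FreeStarAlgebra X) :=
  inferInstanceAs (Ring (MonoidAlgebra ℂ (FreeMonoid (X × Bool))))
instance : Algebra ℂ (FreeStarAlgebra X) :=
  inferInstanceAs (Algebra ℂ (MonoidAlgebra ℂ (FreeMonoid (X × Bool))))

/-- The adjoint of a word: reverse the word and exchange `x` and `star x`. -/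
def starWord (w : FreeMonoid (X × Bool)) : FreeMonoid (X × Bool) :=
  FreeMonoid.map (fun l => (l.1, !l.2)) (star w)

theorem starWord_mul (v w : FreeMonoid (X × Bool)) :
    starWord (v * w) = starWord w * starWord v := by
  simp [starWord]

theorem starWord_of (l : X × Bool) : starWord (FreeMonoid.of l) = FreeMonoid.of (l.1, !l.2) := by
  simp [starWord]

theorem starWord_starWord (w : FreeMonoid (X × Bool)) : starWord (starWord w) = w := by
  induction w using FreeMonoid.inductionOn' with
  | one => rfl
  | of_mul l w ih => rw [starWord_mul, starWord_mul, ih, starWord_of, starWord_of]; simp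

/-- The scalar multiple `z • w` of a word. -/
def mono (w : FreeMonoid (X × Bool)) (z : ℂ) : FreeStarAlgebra X := MonoidAlgebra.single w z

theorem mono_mul_mono (v w : FreeMonoid (X × Bool)) (y z : ℂ) :
    mono v y * mono w z = mono (v * w) (y * z) := MonoidAlgebra.single_mul_single _ _ _ _

theorem induction_linear {motive : FreeStarAlgebra X → Prop} (x : FreeStarAlgebra X)
    (zero : motive 0) (add : ∀ x y, motive x → motive y → motive (x + y))
    (mono : ∀ w z, motive (mono w z)) : motive x :=
  MonoidAlgebra.induction_linear (motive := motive) x zero add mono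

instance : Star (FreeStarAlgebra X) where
  star f := MonoidAlgebra.mapDomain starWord
    (MonoidAlgebra.map ((starRingEnd ℂ : ℂ →+* ℂ) : ℂ →+ ℂ) f)

theorem star_mono (w : FreeMonoid (X × Bool)) (z : ℂ) :
    star (mono w z) = mono (starWord w) (star z) := by
  change MonoidAlgebra.mapDomain starWord (MonoidAlgebra.map _ (MonoidAlgebra.single w z)) = _
  rw [MonoidAlgebra.map_single, MonoidAlgebra.mapDomain_single]; rfl

theorem star_add' (f g : FreeStarAlgebra X) : star (f + g) = star f + star g := by
  change MonoidAlgebra.mapDomain starWord (MonoidAlgebra.map _ _) = _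
  exact (congrArg _ (MonoidAlgebra.map_add _ f g)).trans (MonoidAlgebra.mapDomain_add _ _ _)

theorem star_zero' : star (0 : FreeStarAlgebra X) = 0 := by
  have h := star_add' (0 : FreeStarAlgebra X) 0
  simpa using h

instance : StarRing (FreeStarAlgebra X) where
  star_involutive f := by
    induction f using induction_linear with
    | zero => rw [star_zero', star_zero']
    | add f g hf hg => rw [star_add', star_add', hf, hg]
    | mono w z => rw [star_mono, star_mono, starWord_starWord, star_star]
  star_mul f g := by
    induction f using induction_linear with
    | zero => rw [zero_mul, star_zero', mul_zero]
    | add f f' hf hf' => rw [add_mul, star_add', star_add', hf, hf', mul_add]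
    | mono v y =>
      induction g using induction_linear with
      | zero => rw [mul_zero, star_zero', zero_mul]
      | add g g' hg hg' => rw [mul_add, star_add', star_add', hg, hg', add_mul]
      | mono w z =>
        rw [mono_mul_mono, star_mono, star_mono, star_mono, mono_mul_mono, starWord_mul, star_mul]
  star_add := star_add'

theorem smul_mono (r : ℂ) (w : FreeMonoid (X × Bool)) (z : ℂ) :
    r • mono w z = mono w (r * z) := MonoidAlgebra.smul_single r w z

instance : StarModule ℂ (FreeStarAlgebra X) where
  star_smul r f := by
    induction f using induction_linear with
    | zero => rw [smul_zero, star_zero', smul_zero]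
    | add f g hf hg => rw [smul_add, star_add', star_add', hf, hg, smul_add]
    | mono w z => rw [smul_mono, star_mono, star_mono, smul_mono, star_mul']

/-- The generators of the free `*`-algebra. -/
def gen (x : X) : FreeStarAlgebra X := mono (FreeMonoid.of (x, true)) 1

theorem star_gen (x : X) : star (gen x) = mono (FreeMonoid.of (x, false)) 1 := by
  rw [gen, star_mono, starWord_of]; simp

/-- The `*`-homomorphism with prescribed values on the generators. -/
def eval {B : Type*} [Ring B] [Algebra ℂ B] [StarRing B] [StarModule ℂ B] (b : X → B) :
    FreeStarAlgebra X →⋆ₐ[ℂ] B :=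
  let F : FreeMonoid (X × Bool) →* B :=
    FreeMonoid.lift fun l => if l.2 then b l.1 else star (b l.1)
  let φ : FreeStarAlgebra X →ₐ[ℂ] B := MonoidAlgebra.lift ℂ B (FreeMonoid (X × Bool)) F
  { φ with
    map_star' := fun f => by
      have hφ : ∀ w z, φ (mono w z) = z • F w := fun w z => MonoidAlgebra.lift_single F w z
      have hF : ∀ w, F (starWord w) = star (F w) := by
        intro w
        induction w using FreeMonoid.inductionOn' with
        | one => simp [starWord]
        | of_mul l w ih =>
          rw [starWord_mul, map_mul, map_mul, ih, star_mul, starWord_of]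
          congr 1
          rcases l with ⟨x, _ | _⟩ <;> simp [F]
      change φ (star f) = star (φ f)
      induction f using induction_linear with
      | zero => rw [star_zero', map_zero, star_zero]
      | add f g hf hg => rw [star_add', map_add, map_add, star_add, hf, hg]
      | mono w z => rw [star_mono, hφ, hφ, hF, star_smul] }

theorem eval_gen {B : Type*} [Ring B] [Algebra ℂ B] [StarRing B] [StarModule ℂ B] (b : X → B)
    (x : X) : eval b (gen x) = b x := by
  have h : eval b (gen x) = (1 : ℂ) • (FreeMonoid.lift fun l : X × Bool =>
      if l.2 then b l.1 else star (b l.1)) (FreeMonoid.of (x, true)) :=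
    MonoidAlgebra.lift_single _ _ _
  rw [h]; simp

end FreeStarAlgebra

/-- A set of relators on the generators `X` which bounds every generator in every C*-seminorm that
vanishes on the relators. -/
structure Presentation (X : Type) where
  /-- the elements of the free `*`-algebra which are set equal to zero -/
  rel : Set (FreeStarAlgebra X)
  bounded : ∀ x, ∃ C : ℝ, ∀ p : Seminorm ℂ (FreeStarAlgebra X), IsCStarSeminorm p →
    (∀ r ∈ rel, p r = 0) → p (FreeStarAlgebra.gen x) ≤ C

namespace Presentation

variable {X : Type} (R : Presentation X)

/-- The C*-seminorms which vanish on the relators, that is, the C*-seminorms on the `*`-algebra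
generated by `X` subject to the relations. -/
def seminorms : Set (Seminorm ℂ (FreeStarAlgebra X)) :=
  {p | IsCStarSeminorm p ∧ ∀ r ∈ R.rel, p r = 0}

theorem bddAbove_seminorms : BddAbove R.seminorms := by
  have key : ∀ f : FreeStarAlgebra X, ∃ C : ℝ, ∀ p ∈ R.seminorms, p f ≤ C := by
    have hone : ∀ p ∈ R.seminorms, p 1 ≤ 1 := by
      intro p hp
      have h := hp.1.star_mul_self 1
      rw [star_one, mul_one] at h
      nlinarith [sq_nonneg (p 1 - 1)]
    intro f
    induction f using FreeStarAlgebra.induction_linear with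
    | zero => exact ⟨0, fun p _ => by rw [map_zero]⟩
    | add f g hf hg =>
      obtain ⟨C, hC⟩ := hf
      obtain ⟨D, hD⟩ := hg
      exact ⟨C + D, fun p hp => (map_add_le_add p f g).trans (add_le_add (hC p hp) (hD p hp))⟩
    | mono w z =>
      have hw : ∃ C : ℝ, 0 ≤ C ∧ ∀ p ∈ R.seminorms, p (FreeStarAlgebra.mono w 1) ≤ C := by
        induction w using FreeMonoid.inductionOn' with
        | one => exact ⟨1, zero_le_one, hone⟩
        | of_mul l w ih =>
          obtain ⟨C, hC0, hC⟩ := ih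
          obtain ⟨D, hD⟩ := R.bounded l.1
          refine ⟨max D 0 * C, mul_nonneg (le_max_right _ _) hC0, fun p hp => ?_⟩
          have hl : p (FreeStarAlgebra.mono (FreeMonoid.of l) 1) ≤ max D 0 := by
            rcases l with ⟨x, _ | _⟩
            · rw [← FreeStarAlgebra.star_gen]
              exact (hp.1.star_le _).trans ((hD p hp.1 hp.2).trans (le_max_left _ _))
            · exact (hD p hp.1 hp.2).trans (le_max_left _ _)
          have h := hp.1.mul_le (FreeStarAlgebra.mono (FreeMonoid.of l) 1)
            (FreeStarAlgebra.mono w 1)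
          rw [FreeStarAlgebra.mono_mul_mono, mul_one] at h
          exact h.trans (mul_le_mul hl (hC p hp) (apply_nonneg _ _) (le_max_right _ _))
      obtain ⟨C, hC0, hC⟩ := hw
      refine ⟨‖z‖ * C, fun p hp => ?_⟩
      have hz : FreeStarAlgebra.mono w z = z • FreeStarAlgebra.mono w 1 := by
        rw [FreeStarAlgebra.smul_mono, mul_one]
      rw [hz, map_smul_eq_mul]
      exact mul_le_mul_of_nonneg_left (hC p hp) (norm_nonneg _)
  choose C hC using key
  rw [Seminorm.bddAbove_iff]
  refine ⟨C, ?_⟩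
  rintro _ ⟨p, hp, rfl⟩ f
  exact hC f p hp

/-- The largest C*-seminorm of the `*`-algebra generated by `X` subject to the relations. -/
def maxSeminorm : Seminorm ℂ (FreeStarAlgebra X) := sSup R.seminorms

theorem isCStarSeminorm_max : IsCStarSeminorm R.maxSeminorm :=
  isCStarSeminorm_sSup (fun _ hp => hp.1) R.bddAbove_seminorms

/-- The universal enveloping C*-algebra of the unital `*`-algebra generated by `X` subject to the
relations. -/
def Univ : Type := CStarCompletion R.maxSeminorm R.isCStarSeminorm_max

instance : CStarAlgebra R.Univ :=
  inferInstanceAs (CStarAlgebra (CStarCompletion R.maxSeminorm R.isCStarSeminorm_max))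

/-- The class in `R.Univ` of an element of the free `*`-algebra. -/
def toUniv : FreeStarAlgebra X →⋆ₐ[ℂ] R.Univ := CStarCompletion.of R.maxSeminorm R.isCStarSeminorm_max

/-- The canonical generators of `R.Univ`. -/
def gen (x : X) : R.Univ := R.toUniv (FreeStarAlgebra.gen x)

theorem toUniv_rel {r : FreeStarAlgebra X} (hr : r ∈ R.rel) : R.toUniv r = 0 := by
  rw [← norm_eq_zero]
  refine (CStarCompletion.norm_of r).trans ?_
  rw [maxSeminorm, Seminorm.sSup_apply R.bddAbove_seminorms]
  exact le_antisymm (Real.iSup_le (fun p => (p.2.2 r hr).le) le_rfl)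
    (Real.iSup_nonneg fun p => apply_nonneg _ _)

/-- The C*-seminorm `x ↦ ‖f x‖` of a `*`-homomorphism `f` into a C*-algebra. -/
theorem isCStarSeminorm_comp {P : Type*} [Ring P] [Algebra ℂ P] [StarRing P] {B : Type*}
    [CStarAlgebra B] (f : P →⋆ₐ[ℂ] B) :
    IsCStarSeminorm ((normSeminorm ℂ B).comp (f.toAlgHom.toLinearMap)) where
  mul_le x y := by
    change ‖f (x * y)‖ ≤ ‖f x‖ * ‖f y‖
    rw [map_mul]; exact norm_mul_le _ _
  star_mul_self x := by
    change ‖f (star x * x)‖ = ‖f x‖ ^ 2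
    rw [map_mul, map_star, CStarRing.norm_star_mul_self, sq]

/-- The universal property: elements of a C*-algebra which satisfy the relations define a
`*`-homomorphism. -/
def lift {B : Type*} [CStarAlgebra B] (b : X → B)
    (hb : ∀ r ∈ R.rel, FreeStarAlgebra.eval b r = 0) : R.Univ →⋆ₐ[ℂ] B :=
  CStarCompletion.lift (FreeStarAlgebra.eval b) fun x =>
    by
      have hp : (normSeminorm ℂ B).comp
          ((FreeStarAlgebra.eval b).toAlgHom.toLinearMap) ∈ R.seminorms :=
        ⟨isCStarSeminorm_comp _, fun r hr => by
          change ‖FreeStarAlgebra.eval b r‖ = 0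
          rw [hb r hr, norm_zero]⟩
      exact le_csSup R.bddAbove_seminorms hp x

theorem lift_gen {B : Type*} [CStarAlgebra B] (b : X → B)
    (hb : ∀ r ∈ R.rel, FreeStarAlgebra.eval b r = 0) (x : X) : R.lift b hb (R.gen x) = b x :=
  (CStarCompletion.lift_of _ _ _).trans (FreeStarAlgebra.eval_gen b x)

end Presentation

end IdemU02

namespace IdemU02

/-! ### The spatial tensor product -/

section Spatial

variable {A : Type*} {B : Type*} [CStarAlgebra A] [CStarAlgebra B]

section Rep

variable {H K : Type*} [NormedAddCommGroup H] [InnerProductSpace ℂ H] [CompleteSpace H]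
  [NormedAddCommGroup K] [InnerProductSpace ℂ K] [CompleteSpace K]

/-- The tensor product `π ⊗ ρ` of two Hilbert space representations, determined by
`(π ⊗ ρ) (a ⊗ b) = π a ⊗ ρ b`. The operators act on the algebraic tensor product of the two Hilbert
spaces with its inner product, a dense subspace of the Hilbert space tensor product. -/
def tensorRep (π : A →⋆ₐ[ℂ] (H →L[ℂ] H)) (ρ : B →⋆ₐ[ℂ] (K →L[ℂ] K)) :
    A ⊗[ℂ] B →ₐ[ℂ] ((H ⊗[ℂ] K) →L[ℂ] (H ⊗[ℂ] K)) :=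
  Algebra.TensorProduct.lift
    (AlgHom.ofLinearMap
      { toFun := fun a => (π a).rTensor K
        map_add' := fun a b => by rw [map_add, ContinuousLinearMap.rTensor_add]
        map_smul' := fun r a => by
          rw [map_smul, ContinuousLinearMap.rTensor_smul, RingHom.id_apply] }
      (by simp) (fun a b => by simp [ContinuousLinearMap.rTensor_mul]))
    (AlgHom.ofLinearMap
      { toFun := fun b => (ρ b).lTensor H
        map_add' := fun a b => by rw [map_add, ContinuousLinearMap.lTensor_add]
        map_smul' := fun r a => by
          rw [map_smul, ContinuousLinearMap.lTensor_smul, RingHom.id_apply] }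
      (by simp) (fun a b => by simp [ContinuousLinearMap.lTensor_mul]))
    (fun a b => by
      change (π a).rTensor K ∘L (ρ b).lTensor H = (ρ b).lTensor H ∘L (π a).rTensor K
      rw [ContinuousLinearMap.lTensor_comp_rTensor, ContinuousLinearMap.rTensor_comp_lTensor])

theorem tensorRep_tmul (π : A →⋆ₐ[ℂ] (H →L[ℂ] H)) (ρ : B →⋆ₐ[ℂ] (K →L[ℂ] K)) (a : A) (b : B) :
    tensorRep π ρ (a ⊗ₜ b) = TensorProduct.mapL (π a) (ρ b) := by
  rw [tensorRep, Algebra.TensorProduct.lift_tmul]; rfl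

theorem inner_tensorRep (π : A →⋆ₐ[ℂ] (H →L[ℂ] H)) (ρ : B →⋆ₐ[ℂ] (K →L[ℂ] K)) (x : A ⊗[ℂ] B)
    (u v : H ⊗[ℂ] K) :
    inner ℂ (tensorRep π ρ (star x) u) v = inner ℂ u (tensorRep π ρ x v) := by
  induction x using TensorProduct.induction_on with
  | zero => simp
  | add x y hx hy => simp [inner_add_left, inner_add_right, hx, hy]
  | tmul a b =>
    rw [TensorProduct.star_tmul, tensorRep_tmul, tensorRep_tmul]
    induction u using TensorProduct.induction_on with
    | zero => simp
    | add u w hu hw => simp only [map_add, inner_add_left, hu, hw]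
    | tmul h k =>
      induction v using TensorProduct.induction_on with
      | zero => simp
      | add v w hv hw => simp only [map_add, inner_add_right, hv, hw]
      | tmul h' k' =>
        rw [TensorProduct.mapL_tmul, TensorProduct.mapL_tmul, TensorProduct.inner_tmul,
          TensorProduct.inner_tmul, map_star, map_star, ContinuousLinearMap.star_eq_adjoint,
          ContinuousLinearMap.star_eq_adjoint, ContinuousLinearMap.adjoint_inner_left,
          ContinuousLinearMap.adjoint_inner_left]

/-- The seminorm `x ↦ ‖(π ⊗ ρ) x‖`. -/
def repSeminorm (π : A →⋆ₐ[ℂ] (H →L[ℂ] H)) (ρ : B →⋆ₐ[ℂ] (K →L[ℂ] K)) :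
    Seminorm ℂ (A ⊗[ℂ] B) :=
  (normSeminorm ℂ ((H ⊗[ℂ] K) →L[ℂ] (H ⊗[ℂ] K))).comp (tensorRep π ρ).toLinearMap

theorem repSeminorm_apply (π : A →⋆ₐ[ℂ] (H →L[ℂ] H)) (ρ : B →⋆ₐ[ℂ] (K →L[ℂ] K)) (x : A ⊗[ℂ] B) :
    repSeminorm π ρ x = ‖tensorRep π ρ x‖ := rfl

theorem isCStarSeminorm_rep (π : A →⋆ₐ[ℂ] (H →L[ℂ] H)) (ρ : B →⋆ₐ[ℂ] (K →L[ℂ] K)) :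
    IsCStarSeminorm (repSeminorm π ρ) := by
  have hsq : ∀ x, repSeminorm π ρ x ^ 2 ≤ repSeminorm π ρ (star x * x) := by
    intro x
    have h : repSeminorm π ρ x ≤ Real.sqrt (repSeminorm π ρ (star x * x)) := by
      refine ContinuousLinearMap.opNorm_le_bound _ (Real.sqrt_nonneg _) fun u => ?_
      refine le_of_sq_le_sq ?_ (mul_nonneg (Real.sqrt_nonneg _) (norm_nonneg _))
      rw [mul_pow, Real.sq_sqrt (apply_nonneg _ _)]
      have h1 : ‖tensorRep π ρ x u‖ ^ 2 = RCLike.re (inner ℂ (tensorRep π ρ (star x * x) u) u) := by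
        rw [map_mul]
        change _ = RCLike.re (inner ℂ (tensorRep π ρ (star x) (tensorRep π ρ x u)) u)
        rw [inner_tensorRep]
        exact (inner_self_eq_norm_sq (𝕜 := ℂ) (tensorRep π ρ x u)).symm
      change ‖tensorRep π ρ x u‖ ^ 2 ≤ _
      rw [h1]
      refine (Complex.re_le_norm _).trans ((norm_inner_le_norm (𝕜 := ℂ)
        (tensorRep π ρ (star x * x) u) u).trans ?_)
      rw [sq, ← mul_assoc]
      exact mul_le_mul_of_nonneg_right (ContinuousLinearMap.le_opNorm _ _) (norm_nonneg _)
    calc repSeminorm π ρ x ^ 2 ≤ Real.sqrt (repSeminorm π ρ (star x * x)) ^ 2 :=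
          pow_le_pow_left₀ (apply_nonneg _ _) h 2
      _ = _ := Real.sq_sqrt (apply_nonneg _ _)
  have hmul : ∀ x y, repSeminorm π ρ (x * y) ≤ repSeminorm π ρ x * repSeminorm π ρ y := by
    intro x y
    rw [repSeminorm_apply, map_mul]
    exact ContinuousLinearMap.opNorm_comp_le _ _
  have hle : ∀ x, repSeminorm π ρ x ≤ repSeminorm π ρ (star x) := by
    intro x
    rcases (apply_nonneg (repSeminorm π ρ) x).eq_or_lt with h0 | h0
    · rw [← h0]; exact apply_nonneg _ _
    · have h2 := (hsq x).trans (hmul (star x) x)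
      rw [sq] at h2
      exact le_of_mul_le_mul_right h2 h0
  refine ⟨hmul, fun x => le_antisymm ?_ (hsq x)⟩
  rw [sq]
  refine (hmul _ _).trans (mul_le_mul_of_nonneg_right ?_ (apply_nonneg _ _))
  simpa using hle (star x)

end Rep

end Spatial

section SpatialDef

universe u v

variable (A : Type u) (B : Type v) [CStarAlgebra A] [CStarAlgebra B]

/-- The seminorms `x ↦ ‖(π ⊗ ρ) x‖`, where `π` and `ρ` run through the representations of `A` and
`B` on Hilbert spaces. -/
def spatialSeminorms : Set (Seminorm ℂ (A ⊗[ℂ] B)) :=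
  {p | ∃ (H : Type u) (_ : NormedAddCommGroup H) (_ : InnerProductSpace ℂ H) (_ : CompleteSpace H)
      (K : Type v) (_ : NormedAddCommGroup K) (_ : InnerProductSpace ℂ K) (_ : CompleteSpace K)
      (π : A →⋆ₐ[ℂ] (H →L[ℂ] H)) (ρ : B →⋆ₐ[ℂ] (K →L[ℂ] K)), p = repSeminorm π ρ}

theorem isCStarSeminorm_of_mem {p : Seminorm ℂ (A ⊗[ℂ] B)} (hp : p ∈ spatialSeminorms A B) :
    IsCStarSeminorm p := by
  obtain ⟨H, _, _, _, K, _, _, _, π, ρ, rfl⟩ := hp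
  exact isCStarSeminorm_rep π ρ

theorem bddAbove_spatialSeminorms : BddAbove (spatialSeminorms A B) := by
  have key : ∀ x : A ⊗[ℂ] B, ∃ C : ℝ, ∀ p ∈ spatialSeminorms A B, p x ≤ C := by
    intro x
    induction x using TensorProduct.induction_on with
    | zero => exact ⟨0, fun p _ => by rw [map_zero]⟩
    | add f g hf hg =>
      obtain ⟨C, hC⟩ := hf
      obtain ⟨D, hD⟩ := hg
      exact ⟨C + D, fun p hp => (map_add_le_add p f g).trans (add_le_add (hC p hp) (hD p hp))⟩
    | tmul a b =>
      refine ⟨‖a‖ * ‖b‖, ?_⟩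
      rintro p ⟨H, _, _, _, K, _, _, _, π, ρ, rfl⟩
      rw [repSeminorm_apply, tensorRep_tmul]
      exact (TensorProduct.norm_mapL_le _ _).trans
        (mul_le_mul (NonUnitalStarAlgHom.norm_apply_le π a) (NonUnitalStarAlgHom.norm_apply_le ρ b)
          (norm_nonneg _) (norm_nonneg _))
  choose C hC using key
  rw [Seminorm.bddAbove_iff]
  refine ⟨C, ?_⟩
  rintro _ ⟨p, hp, rfl⟩ f
  exact hC f p hp

/-- The spatial C*-norm on the algebraic tensor product. -/
def spatialSeminorm : Seminorm ℂ (A ⊗[ℂ] B) := sSup (spatialSeminorms A B)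

theorem isCStarSeminorm_spatial : IsCStarSeminorm (spatialSeminorm A B) :=
  isCStarSeminorm_sSup (fun _ hp => isCStarSeminorm_of_mem A B hp) (bddAbove_spatialSeminorms A B)

/-- The spatial (minimal) tensor product of two unital C*-algebras. -/
def SpatialTensor : Type (max u v) :=
  CStarCompletion (spatialSeminorm A B) (isCStarSeminorm_spatial A B)

instance : CStarAlgebra (SpatialTensor A B) :=
  inferInstanceAs (CStarAlgebra (CStarCompletion (spatialSeminorm A B)
    (isCStarSeminorm_spatial A B)))

namespace SpatialTensor

/-- The canonical map from the algebraic to the spatial tensor product. -/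
def ofAlg : A ⊗[ℂ] B →⋆ₐ[ℂ] SpatialTensor A B :=
  CStarCompletion.of (spatialSeminorm A B) (isCStarSeminorm_spatial A B)

theorem denseRange_ofAlg : DenseRange (ofAlg A B) :=
  CStarCompletion.denseRange_of (hp := isCStarSeminorm_spatial A B)

theorem norm_ofAlg (x : A ⊗[ℂ] B) : ‖ofAlg A B x‖ = spatialSeminorm A B x :=
  CStarCompletion.norm_of (hp := isCStarSeminorm_spatial A B) x

variable {A B}

/-- The elementary tensor `a ⊗ b` in the spatial tensor product. -/
def tmul (a : A) (b : B) : SpatialTensor A B := ofAlg A B (a ⊗ₜ b)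

theorem tmul_mul_tmul (a a' : A) (b b' : B) : tmul a b * tmul a' b' = tmul (a * a') (b * b') := by
  rw [tmul, tmul, ← map_mul, Algebra.TensorProduct.tmul_mul_tmul, tmul]

theorem star_tmul (a : A) (b : B) : star (tmul a b) = tmul (star a) (star b) := by
  rw [tmul, ← map_star, TensorProduct.star_tmul, tmul]

theorem tmul_one_one : tmul (1 : A) (1 : B) = 1 := map_one (ofAlg A B)

theorem zero_tmul (b : B) : tmul (0 : A) b = 0 := by
  rw [tmul, TensorProduct.zero_tmul, map_zero]

theorem tmul_zero (a : A) : tmul a (0 : B) = 0 := by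
  rw [tmul, TensorProduct.tmul_zero, map_zero]

theorem add_tmul (a a' : A) (b : B) : tmul (a + a') b = tmul a b + tmul a' b := by
  rw [tmul, TensorProduct.add_tmul, map_add]; rfl

theorem tmul_add (a : A) (b b' : B) : tmul a (b + b') = tmul a b + tmul a b' := by
  rw [tmul, TensorProduct.tmul_add, map_add]; rfl

end SpatialTensor

end SpatialDef

/-! ### States -/

/-- A state on a unital C*-algebra: a bounded linear functional which is positive and unital. -/
structure CStarState (A : Type*) [CStarAlgebra A] where
  /-- the underlying functional -/
  toCLM : A →L[ℂ] ℂ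
  map_one' : toCLM 1 = 1
  nonneg' : ∀ x, 0 ≤ toCLM (star x * x)

namespace CStarState

instance {A : Type*} [CStarAlgebra A] : CoeFun (CStarState A) (fun _ => A → ℂ) :=
  ⟨fun φ => φ.toCLM⟩

theorem ext {A : Type*} [CStarAlgebra A] {φ ψ : CStarState A} (h : ∀ x, φ x = ψ x) : φ = ψ := by
  obtain ⟨f, _, _⟩ := φ
  obtain ⟨g, _, _⟩ := ψ
  congr
  exact ContinuousLinearMap.ext h

/-- The state `φ ∘ f` for a unital `*`-homomorphism `f`. -/
def comp {A B : Type*} [CStarAlgebra A] [CStarAlgebra B] (φ : CStarState B) (f : A →⋆ₐ[ℂ] B) :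
    CStarState A where
  toCLM := φ.toCLM.comp (f.toAlgHom.toLinearMap.mkContinuous 1 fun x => by
    rw [one_mul]; exact NonUnitalStarAlgHom.norm_apply_le f x)
  map_one' := by
    change φ (f 1) = 1
    rw [map_one, φ.map_one']
  nonneg' x := by
    change 0 ≤ φ (f (star x * x))
    rw [map_mul, map_star]; exact φ.nonneg' _

theorem comp_apply {A B : Type*} [CStarAlgebra A] [CStarAlgebra B] (φ : CStarState B)
    (f : A →⋆ₐ[ℂ] B) (x : A) : φ.comp f x = φ (f x) := rfl

universe u v

/-- Every state is a vector state of some representation. -/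
theorem exists_vector {A : Type u} [CStarAlgebra A] (φ : CStarState A) :
    ∃ (H : Type u) (_ : NormedAddCommGroup H) (_ : InnerProductSpace ℂ H) (_ : CompleteSpace H)
      (π : A →⋆ₐ[ℂ] (H →L[ℂ] H)) (ξ : H), ‖ξ‖ = 1 ∧ ∀ a, φ a = inner ℂ ξ (π a ξ) := by
  let _ := CStarAlgebra.spectralOrder A
  have _ := CStarAlgebra.spectralOrderedRing A
  let f : A →ₚ[ℂ] ℂ := PositiveLinearMap.mk₀ φ.toCLM.toLinearMap fun x hx => by
    obtain ⟨y, rfl⟩ := CStarAlgebra.nonneg_iff_eq_star_mul_self.mp hx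
    exact φ.nonneg' y
  have hξ : ∀ a, φ a = inner ℂ (f.toPreGNS 1 : f.GNS) (f.gnsStarAlgHom a (f.toPreGNS 1 : f.GNS)) := by
    intro a
    change f a = _
    change f a = inner ℂ _ (f.gnsNonUnitalStarAlgHom a _)
    rw [PositiveLinearMap.gnsNonUnitalStarAlgHom_apply_coe,
      UniformSpace.Completion.inner_coe, PositiveLinearMap.preGNS_inner_def]
    simp
  refine ⟨f.GNS, inferInstance, inferInstance, inferInstance, f.gnsStarAlgHom,
    (f.toPreGNS 1 : f.GNS), ?_, hξ⟩
  have h := hξ 1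
  rw [φ.map_one', map_one f.gnsStarAlgHom] at h
  change 1 = inner ℂ (f.toPreGNS 1 : f.GNS) (f.toPreGNS 1 : f.GNS) at h
  rw [inner_self_eq_norm_sq_to_K] at h
  have h2 : ‖(f.toPreGNS 1 : f.GNS)‖ ^ 2 = 1 := 
    (RCLike.ofReal_inj (K := ℂ)).mp (by push_cast; exact h.symm)
  exact (pow_eq_one_iff_of_nonneg (norm_nonneg _) two_ne_zero).mp h2

/-- The product functional `φ ⊗ ψ` on the algebraic tensor product. -/
def algTensor {A : Type u} {B : Type v} [CStarAlgebra A] [CStarAlgebra B] (φ : CStarState A)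
    (ψ : CStarState B) : A ⊗[ℂ] B →ₗ[ℂ] ℂ :=
  LinearMap.mul' ℂ ℂ ∘ₗ TensorProduct.map φ.toCLM.toLinearMap ψ.toCLM.toLinearMap

theorem exists_vector_tensor {A : Type u} {B : Type v} [CStarAlgebra A] [CStarAlgebra B]
    (φ : CStarState A) (ψ : CStarState B) :
    ∃ (H : Type u) (_ : NormedAddCommGroup H) (_ : InnerProductSpace ℂ H) (_ : CompleteSpace H)
      (K : Type v) (_ : NormedAddCommGroup K) (_ : InnerProductSpace ℂ K) (_ : CompleteSpace K)
      (π : A →⋆ₐ[ℂ] (H →L[ℂ] H)) (ρ : B →⋆ₐ[ℂ] (K →L[ℂ] K)) (ζ : H ⊗[ℂ] K),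
      ‖ζ‖ = 1 ∧ ∀ x, algTensor φ ψ x = inner ℂ ζ (tensorRep π ρ x ζ) := by
  obtain ⟨H, _, _, _, π, ξ, hξ, hφ⟩ := φ.exists_vector
  obtain ⟨K, _, _, _, ρ, η, hη, hψ⟩ := ψ.exists_vector
  refine ⟨H, _, _, inferInstance, K, _, _, inferInstance, π, ρ, ξ ⊗ₜ η, ?_, fun x => ?_⟩
  · rw [TensorProduct.norm_tmul, hξ, hη, one_mul]
  · induction x using TensorProduct.induction_on with
    | zero => simp
    | add x y hx hy => simp [inner_add_right, hx, hy]
    | tmul a b =>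
      rw [tensorRep_tmul, TensorProduct.mapL_tmul, TensorProduct.inner_tmul, ← hφ, ← hψ]
      rfl

theorem norm_algTensor_le {A : Type u} {B : Type v} [CStarAlgebra A] [CStarAlgebra B]
    (φ : CStarState A) (ψ : CStarState B) (x : A ⊗[ℂ] B) :
    ‖algTensor φ ψ x‖ ≤ spatialSeminorm A B x := by
  obtain ⟨H, _, _, _, K, _, _, _, π, ρ, ζ, hζ, h⟩ := exists_vector_tensor φ ψ
  rw [h]
  calc ‖inner ℂ ζ (tensorRep π ρ x ζ)‖ ≤ ‖ζ‖ * (‖tensorRep π ρ x‖ * ‖ζ‖) :=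
        (norm_inner_le_norm (𝕜 := ℂ) _ _).trans
          (mul_le_mul_of_nonneg_left (ContinuousLinearMap.le_opNorm _ _) (norm_nonneg _))
    _ = repSeminorm π ρ x := by rw [hζ, one_mul, mul_one, repSeminorm_apply]
    _ ≤ spatialSeminorm A B x :=
        le_csSup (bddAbove_spatialSeminorms A B) ⟨H, _, _, _, K, _, _, _, π, ρ, rfl⟩ x

/-- The functional `x ↦ (φ ⊗ ψ) x` on the normed space underlying the algebraic tensor product. -/
def seminormedTensor {A : Type u} {B : Type v} [CStarAlgebra A] [CStarAlgebra B]
    (φ : CStarState A) (ψ : CStarState B) :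
    Seminormed (spatialSeminorm A B) (isCStarSeminorm_spatial A B) →L[ℂ] ℂ :=
  LinearMap.mkContinuous
    (show Seminormed (spatialSeminorm A B) (isCStarSeminorm_spatial A B) →ₗ[ℂ] ℂ from
      algTensor φ ψ) 1
    (fun x => (norm_algTensor_le φ ψ x).trans_eq (one_mul _).symm)

/-- The continuous extension of `φ ⊗ ψ` to the spatial tensor product. -/
def tensorCLM {A : Type u} {B : Type v} [CStarAlgebra A] [CStarAlgebra B]
    (φ : CStarState A) (ψ : CStarState B) : SpatialTensor A B →L[ℂ] ℂ :=
  (seminormedTensor φ ψ).extend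
    (UniformSpace.Completion.toComplL :
      Seminormed (spatialSeminorm A B) (isCStarSeminorm_spatial A B) →L[ℂ] _)

theorem tensorCLM_ofAlg {A : Type u} {B : Type v} [CStarAlgebra A] [CStarAlgebra B]
    (φ : CStarState A) (ψ : CStarState B) (x : A ⊗[ℂ] B) :
    tensorCLM φ ψ (SpatialTensor.ofAlg A B x) = algTensor φ ψ x :=
  ContinuousLinearMap.extend_eq (seminormedTensor φ ψ)
    (UniformSpace.Completion.denseRange_coe)
    (UniformSpace.Completion.isUniformInducing_coe _) x

/-- The product state `φ ⊗ ψ` on the spatial tensor product. -/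
def tensor {A : Type u} {B : Type v} [CStarAlgebra A] [CStarAlgebra B]
    (φ : CStarState A) (ψ : CStarState B) : CStarState (SpatialTensor A B) where
  toCLM := tensorCLM φ ψ
  map_one' := by
    rw [← map_one (SpatialTensor.ofAlg A B), tensorCLM_ofAlg, Algebra.TensorProduct.one_def]
    change φ 1 * ψ 1 = 1
    rw [φ.map_one', ψ.map_one', one_mul]
  nonneg' x := by
    induction x using (SpatialTensor.denseRange_ofAlg A B).induction_on with
    | hp =>
      exact isClosed_le continuous_const
        ((tensorCLM φ ψ).continuous.comp (continuous_star.mul continuous_id))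
    | ih x =>
      rw [← map_star, ← map_mul, tensorCLM_ofAlg]
      obtain ⟨H, _, _, _, K, _, _, _, π, ρ, ζ, hζ, h⟩ := exists_vector_tensor φ ψ
      rw [h, map_mul]
      change 0 ≤ inner ℂ ζ (tensorRep π ρ (star x) (tensorRep π ρ x ζ))
      have h1 := inner_tensorRep π ρ (star x) ζ (tensorRep π ρ x ζ)
      rw [star_star] at h1
      rw [← h1]
      refine le_of_le_of_eq ?_ (inner_self_eq_norm_sq_to_K (𝕜 := ℂ) (tensorRep π ρ x ζ)).symm
      have h2 : (0 : ℂ) ≤ ((‖tensorRep π ρ x ζ‖ ^ 2 : ℝ) : ℂ) :=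
        Complex.zero_le_real.mpr (sq_nonneg _)
      rwa [Complex.ofReal_pow] at h2

theorem tensor_tmul {A : Type u} {B : Type v} [CStarAlgebra A] [CStarAlgebra B]
    (φ : CStarState A) (ψ : CStarState B) (a : A) (b : B) :
    φ.tensor ψ (SpatialTensor.tmul a b) = φ a * ψ b := tensorCLM_ofAlg φ ψ (a ⊗ₜ b)

/-- The convolution product `(φ ⊗ ψ) ∘ Δ`. -/
def conv {A : Type u} [CStarAlgebra A] (Δ : A →⋆ₐ[ℂ] SpatialTensor A A) (φ ψ : CStarState A) :
    CStarState A := (φ.tensor ψ).comp Δ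

/-- A state is idempotent if `(φ ⊗ φ) ∘ Δ = φ`. -/
def IsIdempotent {A : Type u} [CStarAlgebra A] (Δ : A →⋆ₐ[ℂ] SpatialTensor A A)
    (φ : CStarState A) : Prop := conv Δ φ φ = φ

end CStarState

end IdemU02

namespace IdemU02

/-! ### The compact quantum semigroups `U_0(2)` and `SU_0(2)` -/

/-- In a C*-seminorm, an element `x` with `p (star x * x) ≤ C` satisfies `p x ≤ C + 1`. -/
theorem IsCStarSeminorm.le_of_sq {P : Type*} [Ring P] [Algebra ℂ P] [StarRing P]
    {p : Seminorm ℂ P} (hp : IsCStarSeminorm p) {x : P} {C : ℝ} (h : p (star x * x) ≤ C) :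
    p x ≤ C + 1 := by
  rw [hp.star_mul_self] at h
  nlinarith [sq_nonneg (p x - 1)]

theorem IsCStarSeminorm.one_le {P : Type*} [Ring P] [Algebra ℂ P] [StarRing P]
    {p : Seminorm ℂ P} (hp : IsCStarSeminorm p) : p 1 ≤ 1 := by
  have h := hp.star_mul_self 1
  rw [star_one, mul_one] at h
  nlinarith [sq_nonneg (p 1 - 1)]

theorem seminorm_eq_of_sub {P : Type*} [Ring P] [Algebra ℂ P] {p : Seminorm ℂ P} {x y : P}
    (h : p (x - y) = 0) : p x = p y := by
  refine le_antisymm ?_ ?_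
  · have h1 := map_add_le_add p (x - y) y
    rwa [sub_add_cancel, h, zero_add] at h1
  · have h1 := map_add_le_add p (y - x) x
    rwa [sub_add_cancel, map_sub_rev, h, zero_add] at h1

/-- `x ^ k` for `k ≥ 0`, and `(star x) ^ (-k)` for `k < 0`. -/
def starPow {A : Type*} [Monoid A] [Star A] (x : A) : ℤ → A
  | Int.ofNat n => x ^ n
  | Int.negSucc n => star x ^ (n + 1)

/-- Names of the generators of `Pol SU_0(2)`. -/
inductive SUGen
  | α
  | γ

/-- Names of the generators of `Pol U_0(2)`. -/
inductive UGen
  | a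
  | c
  | v

open FreeStarAlgebra in
/-- The defining relations of `Pol SU_q(2)` for `q = 0`. -/
def suRel : Set (FreeStarAlgebra SUGen) :=
  let α := gen SUGen.α
  let γ := gen SUGen.γ
  {α * γ, α * star γ, star γ * γ - γ * star γ, star γ * γ + star α * α - 1,
    α * star α - star α * α - star γ * γ}

open FreeStarAlgebra in
/-- The defining relations of `Pol U_q(2)` for `q = 0`. -/
def uRel : Set (FreeStarAlgebra UGen) :=
  let a := gen UGen.a
  let c := gen UGen.c
  let v := gen UGen.v
  {a * v - v * a, c * v - v * c, c * star c - star c * c, a * c, a * star c,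
    v * star v - 1, star v * v - 1, a * star a - 1, star a * a + star c * c - 1}

/-- `SU_0(2)`: generators `α`, `γ` and their relations. -/
def suPres : Presentation SUGen where
  rel := suRel
  bounded := by
    have key : ∀ p : Seminorm ℂ (FreeStarAlgebra SUGen), IsCStarSeminorm p →
        (∀ r ∈ suRel, p r = 0) →
        p (FreeStarAlgebra.gen SUGen.α) ≤ 2 ∧ p (FreeStarAlgebra.gen SUGen.γ) ≤ 6 := by
      intro p hp hr
      set α := FreeStarAlgebra.gen SUGen.α with hα
      set γ := FreeStarAlgebra.gen SUGen.γ with hγ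
      have h4 : p (star γ * γ + star α * α - 1) = 0 := hr _ (by simp [suRel, ← hα, ← hγ])
      have h5 : p (α * star α - star α * α - star γ * γ) = 0 := hr _ (by simp [suRel, ← hα, ← hγ])
      have h6 : p (α * star α - 1) = 0 := by
        refine le_antisymm ?_ (apply_nonneg _ _)
        have h := map_add_le_add p (α * star α - star α * α - star γ * γ)
          (star γ * γ + star α * α - 1)
        rwa [h4, h5, add_zero, show α * star α - star α * α - star γ * γ +
          (star γ * γ + star α * α - 1) = α * star α - 1 by abel] at h
      have hαs : p (star α) ≤ 1 + 1 := hp.le_of_sq (by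
        rw [star_star, seminorm_eq_of_sub h6]; exact hp.one_le)
      have hα2 : p α ≤ 2 := by
        have h := hp.star_le (star α)
        rw [star_star] at h
        linarith
      refine ⟨hα2, ?_⟩
      have h7 : p (star γ * γ) ≤ 5 := by
        have h8 : p (star γ * γ) = p (1 - star α * α) := seminorm_eq_of_sub (by
          rw [show star γ * γ - (1 - star α * α) = star γ * γ + star α * α - 1 by abel]
          exact h4)
        rw [h8]
        have h9 := map_sub_le_add p 1 (star α * α)
        rw [hp.star_mul_self] at h9
        nlinarith [hp.one_le, apply_nonneg p α]
      have := hp.le_of_sq h7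
      linarith
    rintro (_ | _)
    · exact ⟨2, fun p hp hr => (key p hp hr).1⟩
    · exact ⟨6, fun p hp hr => (key p hp hr).2⟩

/-- `U_0(2)`: generators `a`, `c`, `v` and their relations. -/
def uPres : Presentation UGen where
  rel := uRel
  bounded := by
    have key : ∀ p : Seminorm ℂ (FreeStarAlgebra UGen), IsCStarSeminorm p →
        (∀ r ∈ uRel, p r = 0) → p (FreeStarAlgebra.gen UGen.a) ≤ 2 ∧
        p (FreeStarAlgebra.gen UGen.c) ≤ 6 ∧ p (FreeStarAlgebra.gen UGen.v) ≤ 2 := by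
      intro p hp hr
      set a := FreeStarAlgebra.gen UGen.a with ha
      set c := FreeStarAlgebra.gen UGen.c with hc
      set v := FreeStarAlgebra.gen UGen.v with hv
      have h4 : p (star a * a + star c * c - 1) = 0 := hr _ (by simp [uRel, ← ha, ← hc])
      have h6 : p (a * star a - 1) = 0 := hr _ (by simp [uRel, ← ha])
      have hvv : p (star v * v - 1) = 0 := hr _ (by simp [uRel, ← hv])
      have has : p (star a) ≤ 1 + 1 := hp.le_of_sq (by
        rw [star_star, seminorm_eq_of_sub h6]; exact hp.one_le)
      have ha2 : p a ≤ 2 := by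
        have h := hp.star_le (star a)
        rw [star_star] at h
        linarith
      refine ⟨ha2, ?_, ?_⟩
      · have h7 : p (star c * c) ≤ 5 := by
          have h8 : p (star c * c) = p (1 - star a * a) := seminorm_eq_of_sub (by
            rw [show star c * c - (1 - star a * a) = star a * a + star c * c - 1 by abel]
            exact h4)
          rw [h8]
          have h9 := map_sub_le_add p 1 (star a * a)
          rw [hp.star_mul_self] at h9
          nlinarith [hp.one_le, apply_nonneg p a]
        have := hp.le_of_sq h7
        linarith
      · have := hp.le_of_sq (x := v) (C := 1) (by
          rw [seminorm_eq_of_sub hvv]; exact hp.one_le)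
        linarith
    rintro (_ | _ | _)
    · exact ⟨2, fun p hp hr => (key p hp hr).1⟩
    · exact ⟨6, fun p hp hr => (key p hp hr).2.1⟩
    · exact ⟨2, fun p hp hr => (key p hp hr).2.2⟩

/-- The C*-algebra `C(SU_0(2))`. -/
abbrev CSU : Type := suPres.Univ

/-- The C*-algebra `C(U_0(2))`. -/
abbrev CU : Type := uPres.Univ

/-- A pair of elements satisfying the relations of `SU_0(2)`. -/
structure SURelations {B : Type*} [Ring B] [StarRing B] (α γ : B) : Prop where
  mul : α * γ = 0
  mul_star : α * star γ = 0
  normal : star γ * γ = γ * star γ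
  add : star γ * γ + star α * α = 1
  sub : α * star α - star α * α = star γ * γ

/-- A triple of elements satisfying the relations of `U_0(2)`. -/
structure URelations {B : Type*} [Ring B] [StarRing B] (a c v : B) : Prop where
  av : a * v = v * a
  cv : c * v = v * c
  normal : c * star c = star c * c
  mul : a * c = 0
  mul_star : a * star c = 0
  v_star : v * star v = 1
  star_v : star v * v = 1
  a_star : a * star a = 1
  add : star a * a + star c * c = 1

/-- The generator `α` of `C(SU_0(2))`. -/
def suα : CSU := suPres.gen SUGen.α
/-- The generator `γ` of `C(SU_0(2))`. -/
def suγ : CSU := suPres.gen SUGen.γ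
/-- The generator `a` of `C(U_0(2))`. -/
def ua : CU := uPres.gen UGen.a
/-- The generator `c` of `C(U_0(2))`. -/
def uc : CU := uPres.gen UGen.c
/-- The generator `v` of `C(U_0(2))`. -/
def uv : CU := uPres.gen UGen.v

theorem suRelations : SURelations suα suγ := by
  have h : ∀ r ∈ suRel, suPres.toUniv r = 0 := fun r hr => suPres.toUniv_rel hr
  simp only [suRel, Set.mem_insert_iff, Set.mem_singleton_iff, forall_eq_or_imp, forall_eq,
    map_mul, map_sub, map_add, map_star, map_one] at h
  obtain ⟨h1, h2, h3, h4, h5⟩ := h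
  exact ⟨h1, h2, sub_eq_zero.mp h3, sub_eq_zero.mp h4, sub_eq_zero.mp h5⟩

theorem uRelations : URelations ua uc uv := by
  have h : ∀ r ∈ uRel, uPres.toUniv r = 0 := fun r hr => uPres.toUniv_rel hr
  simp only [uRel, Set.mem_insert_iff, Set.mem_singleton_iff, forall_eq_or_imp, forall_eq,
    map_mul, map_sub, map_add, map_star, map_one] at h
  obtain ⟨h1, h2, h3, h4, h5, h6, h7, h8, h9⟩ := h
  exact ⟨sub_eq_zero.mp h1, sub_eq_zero.mp h2, sub_eq_zero.mp h3, h4, h5, sub_eq_zero.mp h6,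
    sub_eq_zero.mp h7, sub_eq_zero.mp h8, sub_eq_zero.mp h9⟩

/-- The values on the generators of a homomorphism from `C(SU_0(2))`. -/
def suVal {B : Type*} (α γ : B) : SUGen → B
  | SUGen.α => α
  | SUGen.γ => γ

/-- The values on the generators of a homomorphism from `C(U_0(2))`. -/
def uVal {B : Type*} (a c v : B) : UGen → B
  | UGen.a => a
  | UGen.c => c
  | UGen.v => v

/-- The unital `*`-homomorphism on `C(SU_0(2))` with `α ↦ α'` and `γ ↦ γ'`. -/
def suLift {B : Type*} [CStarAlgebra B] {α' γ' : B} (h : SURelations α' γ') : CSU →⋆ₐ[ℂ] B :=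
  suPres.lift (suVal α' γ') (by
    change ∀ r ∈ suRel, _
    simp only [suRel, Set.mem_insert_iff, Set.mem_singleton_iff, forall_eq_or_imp, forall_eq,
      map_mul, map_sub, map_add, map_star, map_one, FreeStarAlgebra.eval_gen, suVal, sub_eq_zero]
    exact ⟨h.mul, h.mul_star, h.normal, h.add, h.sub⟩)

/-- The unital `*`-homomorphism on `C(U_0(2))` with `a ↦ a'`, `c ↦ c'` and `v ↦ v'`. -/
def uLift {B : Type*} [CStarAlgebra B] {a' c' v' : B} (h : URelations a' c' v') : CU →⋆ₐ[ℂ] B :=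
  uPres.lift (uVal a' c' v') (by
    change ∀ r ∈ uRel, _
    simp only [uRel, Set.mem_insert_iff, Set.mem_singleton_iff, forall_eq_or_imp, forall_eq,
      map_mul, map_sub, map_add, map_star, map_one, FreeStarAlgebra.eval_gen, uVal, sub_eq_zero]
    exact ⟨h.av, h.cv, h.normal, h.mul, h.mul_star, h.v_star, h.star_v, h.a_star, h.add⟩)

theorem suLift_α {B : Type*} [CStarAlgebra B] {α' γ' : B} (h : SURelations α' γ') :
    suLift h suα = α' := suPres.lift_gen _ _ _
theorem suLift_γ {B : Type*} [CStarAlgebra B] {α' γ' : B} (h : SURelations α' γ') :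
    suLift h suγ = γ' := suPres.lift_gen _ _ _
theorem uLift_a {B : Type*} [CStarAlgebra B] {a' c' v' : B} (h : URelations a' c' v') :
    uLift h ua = a' := uPres.lift_gen _ _ _
theorem uLift_c {B : Type*} [CStarAlgebra B] {a' c' v' : B} (h : URelations a' c' v') :
    uLift h uc = c' := uPres.lift_gen _ _ _
theorem uLift_v {B : Type*} [CStarAlgebra B] {a' c' v' : B} (h : URelations a' c' v') :
    uLift h uv = v' := uPres.lift_gen _ _ _

/-! #### The coproducts -/

open SpatialTensor

theorem URelations.av_star {B : Type*} [Ring B] [StarRing B] {a c v : B}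
    (h : URelations a c v) : a * star v = star v * a := by
  calc a * star v = star v * v * (a * star v) := by rw [h.star_v, one_mul]
    _ = star v * (v * a) * star v := by noncomm_ring
    _ = star v * a * (v * star v) := by rw [← h.av]; noncomm_ring
    _ = star v * a := by rw [h.v_star, mul_one]

theorem URelations.cv_star {B : Type*} [Ring B] [StarRing B] {a c v : B}
    (h : URelations a c v) : c * star v = star v * c := by
  calc c * star v = star v * v * (c * star v) := by rw [h.star_v, one_mul]
    _ = star v * (v * c) * star v := by noncomm_ring
    _ = star v * c * (v * star v) := by rw [← h.cv]; noncomm_ring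
    _ = star v * c := by rw [h.v_star, mul_one]

theorem su_comul_relations : SURelations (tmul suα suα)
    (tmul suγ suα + tmul (star suα) suγ) := by
  obtain ⟨h1, h2, h3, h4, h5⟩ := suRelations
  have h6 : suα * star suα = 1 := by rw [← h4, ← h5]; abel
  have h1' : star suγ * star suα = 0 := by rw [← star_mul, h1, star_zero]
  have h2' : suγ * star suα = 0 := by
    have := congrArg star h2
    simpa using this
  have hg : star suγ * suγ = 1 - star suα * suα := by rw [← h4]; abel
  have hg' : suγ * star suγ = 1 - star suα * suα := by rw [← h3, hg]
  have hs1 : ∀ x y z : CSU, tmul (x - y) z = tmul x z - tmul y z := by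
    intro x y z
    simp only [tmul, TensorProduct.sub_tmul, map_sub]
  have hs2 : ∀ x y z : CSU, tmul x (y - z) = tmul x y - tmul x z := by
    intro x y z
    simp only [tmul, TensorProduct.tmul_sub, map_sub]
  constructor <;>
  simp only [star_add, SpatialTensor.star_tmul, star_star, mul_add, add_mul, tmul_mul_tmul, h1, h2,
    h1', h2', h6, hg, hg', hs1, hs2, zero_tmul, tmul_zero, tmul_one_one, add_zero, zero_add] <;> abel

theorem u_comul_relations : URelations (tmul ua ua)
    (tmul uc ua + tmul (star ua * star uv) uc) (tmul uv uv) := by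
  have hr := uRelations
  obtain ⟨h1, h2, h3, h4, h5, h6, h7, h8, h9⟩ := uRelations
  have hav := hr.av_star
  have hcv := hr.cv_star
  have h4' : star uc * star ua = 0 := by rw [← star_mul, h4, star_zero]
  have h5' : uc * star ua = 0 := by
    have := congrArg star h5
    simpa using this
  have hg : star uc * uc = 1 - star ua * ua := by rw [← h9]; abel
  have hg' : uc * star uc = 1 - star ua * ua := by rw [h3, hg]
  have hs1 : ∀ x y z : CU, tmul (x - y) z = tmul x z - tmul y z := by
    intro x y z
    simp only [tmul, TensorProduct.sub_tmul, map_sub]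
  have hs2 : ∀ x y z : CU, tmul x (y - z) = tmul x y - tmul x z := by
    intro x y z
    simp only [tmul, TensorProduct.tmul_sub, map_sub]
  have hvs : star ua * star uv = star uv * star ua := by rw [← star_mul, ← star_mul, h1]
  have e1 : ua * (star ua * star uv) = star uv := by rw [← mul_assoc, h8, one_mul]
  have e2 : uv * ua * (star ua * star uv) = 1 := by
    rw [mul_assoc, e1, h6]
  have e3 : star ua * star uv * (uv * ua) = star ua * ua := by
    rw [mul_assoc, ← mul_assoc (star uv), h7, one_mul]
  have e4 : star uc * (star ua * star uv) = 0 := by rw [← mul_assoc, h4', zero_mul]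
  have e5 : uv * ua * uc = 0 := by rw [mul_assoc, h4, mul_zero]
  have e6 : uc * (uv * ua) = uv * (uc * ua) := by rw [← mul_assoc, h2, mul_assoc]
  have e7 : star ua * star uv * uv = star ua := by rw [mul_assoc, h7, mul_one]
  have e8 : uv * (star ua * star uv) = star ua := by rw [hvs, ← mul_assoc, h6, one_mul]
  constructor
  all_goals
    simp only [star_add, star_mul, SpatialTensor.star_tmul, star_star, mul_add, add_mul,
      tmul_mul_tmul, h1, h2, h4, h5, h5', h6, h7, h8, e1, e2, e3, e4, e5, e7, e8,
      hg, hg', hs1, hs2, zero_tmul, tmul_zero, tmul_one_one, add_zero, zero_add]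
  all_goals try abel

/-- The coproduct of `C(SU_0(2))`: `Δ α = α ⊗ α` and `Δ γ = γ ⊗ α + star α ⊗ γ`. -/
def suComul : CSU →⋆ₐ[ℂ] SpatialTensor CSU CSU := suLift su_comul_relations

/-- The coproduct of `C(U_0(2))`: `Δ a = a ⊗ a`, `Δ c = c ⊗ a + star a * star v ⊗ c` and
`Δ v = v ⊗ v`. -/
def uComul : CU →⋆ₐ[ℂ] SpatialTensor CU CU := uLift u_comul_relations

/-! ### Haar states on closed subgroups of compact groups -/

section Haar

open MeasureTheory

variable {G : Type*} [Group G] [TopologicalSpace G] [IsTopologicalGroup G] [CompactSpace G]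

instance (H : ClosedSubgroup G) : IsTopologicalGroup H :=
  inferInstanceAs (IsTopologicalGroup H.toSubgroup)

/-- The integral of a function over a closed subgroup `H` of a compact group, with respect to the
Haar measure of `H` of total mass one. -/
def haarIntegral (H : ClosedSubgroup G) (f : H → ℂ) : ℂ :=
  letI : MeasurableSpace H := borel H
  haveI : BorelSpace H := ⟨rfl⟩
  ∫ h, f h ∂(Measure.haarMeasure (⊤ : TopologicalSpace.PositiveCompacts H))

/-- The state `f ↦ ∫ f dρ` on `C(G)`, where `ρ` is the Haar measure of the closed subgroup `H`. -/
def haarState (H : ClosedSubgroup G) : CStarState C(G, ℂ) :=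
  letI : MeasurableSpace H := borel H
  haveI : BorelSpace H := ⟨rfl⟩
  have hprob : IsProbabilityMeasure
      (Measure.haarMeasure (⊤ : TopologicalSpace.PositiveCompacts H)) :=
    ⟨Measure.haarMeasure_self⟩
  have hint : ∀ f : C(G, ℂ), Integrable (fun h : H => f h)
      (Measure.haarMeasure (⊤ : TopologicalSpace.PositiveCompacts H)) := fun f =>
    (f.continuous.comp continuous_subtype_val).integrable_of_hasCompactSupport
      (HasCompactSupport.of_compactSpace _)
  { toCLM := LinearMap.mkContinuous
      { toFun := fun f => haarIntegral H fun h => f h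
        map_add' := fun f g => integral_add (hint f) (hint g)
        map_smul' := fun r f => integral_const_mul r _ } 1 (fun f => by
          refine (norm_integral_le_of_norm_le_const (C := ‖f‖)
            (μ := Measure.haarMeasure (⊤ : TopologicalSpace.PositiveCompacts H))
            (Filter.Eventually.of_forall fun h => f.norm_coe_le_norm h)).trans ?_
          simp)
    map_one' := by
      change ∫ h : H, (1 : ℂ) ∂_ = 1
      simp
    nonneg' := fun f => by
      change 0 ≤ ∫ h : H, star (f h) * f h ∂_
      have : ∀ h : H, star (f h) * f h = ((‖f h‖ ^ 2 : ℝ) : ℂ) := fun h => by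
        rw [Complex.star_def, Complex.conj_mul', Complex.ofReal_pow]
      simp_rw [this]
      rw [integral_complex_ofReal]
      exact Complex.zero_le_real.mpr (integral_nonneg fun h => sq_nonneg _) }

theorem haarState_apply (H : ClosedSubgroup G) (f : C(G, ℂ)) :
    haarState H f = haarIntegral H fun h => f h := rfl

end Haar

/-! ### The two families of states -/

/-- The two-dimensional torus. -/
abbrev Torus : Type := Circle × Circle

theorem torus_relations : URelations
    (⟨fun z => (z.1 : ℂ), by fun_prop⟩ : C(Torus, ℂ)) 0
    (⟨fun z => (z.2 : ℂ), by fun_prop⟩ : C(Torus, ℂ)) := by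
  constructor <;> ext z <;> simp [mul_comm, Complex.mul_conj]

/-- The homomorphism `C(U_0(2)) → C(T²)` with `a ↦ w₁`, `c ↦ 0` and `v ↦ w₂`, where `w₁` and `w₂`
are the coordinate functions. -/
def piTorus : CU →⋆ₐ[ℂ] C(Torus, ℂ) := uLift torus_relations

/-- The state on `C(U_0(2))` induced by the Haar measure of a closed subgroup of the torus. -/
def torusState (H : ClosedSubgroup Torus) : CStarState CU := (haarState H).comp piTorus

/-- The coordinate function `z ↦ z` in `C(U(1))`. -/
def circleCoord : C(Circle, ℂ) := ⟨fun z => (z : ℂ), by fun_prop⟩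

theorem split_relations : URelations (tmul suα (1 : C(Circle, ℂ))) (tmul suγ 1)
    (tmul (1 : CSU) circleCoord) := by
  obtain ⟨h1, h2, h3, h4, h5⟩ := suRelations
  have h6 : suα * star suα = 1 := by rw [← h4, ← h5]; abel
  have hw : circleCoord * star circleCoord = 1 := by
    ext z
    change (z : ℂ) * star (z : ℂ) = 1
    simp [Complex.mul_conj]
  have hw' : star circleCoord * circleCoord = 1 := by rw [mul_comm, hw]
  constructor <;>
  simp only [SpatialTensor.star_tmul, tmul_mul_tmul, star_one, mul_one, one_mul, h1, h2, h3, h6,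
    hw, hw', zero_tmul, tmul_one_one, ← SpatialTensor.add_tmul]
  rw [add_comm, ← h3, h4, tmul_one_one]

/-- The identification `C(U_0(2)) → C(SU_0(2)) ⊗ C(U(1))` with `a ↦ α ⊗ 1`, `c ↦ γ ⊗ 1` and
`v ↦ 1 ⊗ w`. -/
def split : CU →⋆ₐ[ℂ] SpatialTensor CSU C(Circle, ℂ) := uLift split_relations

/-- The closed subgroup `Z_m` of `U(1)`, the group of the `m`-th roots of unity, for `m = 1, 2, …`,
and the whole of `U(1)` for `m = ∞`. -/
def circleSubgroup : WithTop ℕ+ → ClosedSubgroup Circle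
  | none => ⟨⊤, isClosed_univ⟩
  | some m => ⟨(powMonoidHom (m : ℕ)).ker, by
      change IsClosed {z : Circle | z ^ (m : ℕ) = 1}
      exact isClosed_eq (continuous_pow _) continuous_const⟩

/-- The state `φ_m` on `C(U(1))` given by the Haar measure of `Z_m`, or of `U(1)` for `m = ∞`. -/
def circleState (m : WithTop ℕ+) : CStarState C(Circle, ℂ) := haarState (circleSubgroup m)

/-- The condition `ψ ((star α) ^ r γ ^ k α ^ s) = 1` if `r = s ≤ n` and `k = 0`, and `= 0`
otherwise, for all `r, s ≥ 0` and all integers `k`, where `γ ^ k` means `(star γ) ^ (-k)` for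
`k < 0`. -/
def IsPsi (n : ℕ) (ψ : CStarState CSU) : Prop :=
  ∀ (r s : ℕ) (k : ℤ), ψ (star suα ^ r * starPow suγ k * suα ^ s) =
    if r = s ∧ s ≤ n ∧ k = 0 then 1 else 0

/-- The state `ψ ⊗ φ_m` on `C(U_0(2))`, identified with `C(SU_0(2)) ⊗ C(U(1))`. -/
def prodState (ψ : CStarState CSU) (m : WithTop ℕ+) : CStarState CU :=
  (ψ.tensor (circleState m)).comp split

/-- The function `(w₁, w₂) ↦ w₁ ^ i * w₂ ^ j` on the torus. -/
def torusMonomial (i j : ℤ) (w : Torus) : ℂ := ((w.1 ^ i * w.2 ^ j : Circle) : ℂ)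

theorem counit_relations : URelations (1 : ℂ) 0 1 := by constructor <;> simp

/-- The counit of `U_0(2)`: `a ↦ 1`, `c ↦ 0` and `v ↦ 1`. -/
def uCounit : CU →⋆ₐ[ℂ] ℂ := uLift counit_relations

/-- The trivial subgroup of the torus. -/
def trivialSubgroup : ClosedSubgroup Torus := ⟨⊥, isClosed_singleton⟩

end IdemU02

end

open IdemU02

noncomputable section

open scoped TensorProduct ComplexOrder

namespace IdemU02

/-! ### Powers and monomials -/

section StarPow

variable {A : Type*}

/-! States are compared on the monomials `a*^r c^k a^s v^l`, whose span is dense. In `Δ c = x + y`,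
with `x = c ⊗ a` and `y = a* v* ⊗ c`, one has `x y = 0`, so for `k ≥ 0` the power `(Δ c)^k` is the
sum of the terms `y^j x^(k-j)`. A monomial with `k = 0` is group-like, so an idempotent state takes
the value `0` or `1` on it (`IsUComul.eq_zero_or_one`). For `k > 0` each term of the coproduct has a
nonzero power of `c` in one leg. Hence a state that vanishes for `k ≠ 0` and takes the values `0`
and `1` for `k = 0` is idempotent (`IsUComul.isIdempotent_of_values`), which settles both families.
`SU_0(2)` is the case `v = 1`.

Conversely, let `φ` be idempotent. As `a a* = 1`, the elements `a*^r a^r` are projections decreasing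
in `r`, and `φ` is `0` or `1` on each.

If all values are `1`, then `φ` vanishes on every difference `a*^r (1 - a* a) a^r`. By
Cauchy-Schwarz it cannot see `1 - a* a`, which lies above all nonzero powers of `c`. So `φ` vanishes
for `k ≠ 0` and depends only on `(s - r, l)` for `k = 0` (`IsUComul.exists_fourier`). The pairs with
value `1` form a subgroup of `ℤ × ℤ`, because elements with `φ m = φ (m* m) = 1` can be cancelled
under `φ` (`IsUComul.exists_subgroup`). By duality `φ` comes from the Haar measure of the
annihilator of this subgroup (`forall_mem_annihilator_iff`).

Otherwise the values jump from `1` at some `n` to `0` at `n + 1`, and `φ` lives on the corner of the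
projection `e = a*^n (1 - a* a) a^n`. Compression by `e` kills all monomials except those with `r =
s ≤ n`, `k = 0` and those with `r = s = n`, `k ≠ 0`; the latter vanish by idempotence
(`IsUComul.values_of_jump`). What remains is `φ (v^l)`, the indicator function of a subgroup of `ℤ`,
so `φ = ψ_n ⊗ φ_m`.

The states `ψ_n` are vector states on `ℓ²(ℕ × ℤ)`, where `α` is the backward shift in the first
index and `γ` shifts the second index on the kernel of `α`. -/

theorem starPow_natCast [Monoid A] [Star A] (x : A) (n : ℕ) : starPow x (n : ℤ) = x ^ n := rfl

theorem starPow_neg_natCast [Monoid A] [StarMul A] (x : A) (n : ℕ) :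
    starPow x (-(n : ℤ)) = star x ^ n := by
  cases n with
  -- The exponent `-0` falls under the nonnegative clause of `starPow`, unlike all the others here.
  | zero => exact (pow_zero x).trans (pow_zero (star x)).symm
  | succ n => rfl

theorem starPow_zero [Monoid A] [Star A] (x : A) : starPow x 0 = 1 := pow_zero x

theorem star_starPow [Monoid A] [StarMul A] (x : A) (k : ℤ) :
    star (starPow x k) = starPow x (-k) := by
  obtain ⟨n, rfl | rfl⟩ := k.eq_nat_or_neg
  · rw [starPow_natCast, starPow_neg_natCast, star_pow]
  · rw [neg_neg, starPow_natCast, starPow_neg_natCast, star_pow, star_star]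

theorem map_starPow {B F : Type*} [Monoid A] [StarMul A] [Monoid B] [StarMul B] [FunLike F A B]
    [MonoidHomClass F A B] [StarHomClass F A B] (f : F) (x : A) (k : ℤ) :
    f (starPow x k) = starPow (f x) k := by
  obtain ⟨n, rfl | rfl⟩ := k.eq_nat_or_neg
  · rw [starPow_natCast, starPow_natCast, map_pow]
  · rw [starPow_neg_natCast, starPow_neg_natCast, map_pow, map_star]

theorem one_starPow [Monoid A] [StarMul A] (k : ℤ) : starPow (1 : A) k = 1 := by
  obtain ⟨n, rfl | rfl⟩ := k.eq_nat_or_neg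
  · rw [starPow_natCast, one_pow]
  · rw [starPow_neg_natCast, star_one, one_pow]

theorem zero_starPow [MonoidWithZero A] [StarMul A] (h0 : star (0 : A) = 0) {k : ℤ} (hk : k ≠ 0) :
    starPow (0 : A) k = 0 := by
  obtain ⟨n, rfl | rfl⟩ := k.eq_nat_or_neg
  · rw [starPow_natCast, zero_pow (by simpa using hk)]
  · rw [starPow_neg_natCast, h0, zero_pow (by simpa using hk)]

theorem commute_starPow [Monoid A] [StarMul A] {x y : A} (h : Commute x y)
    (h' : Commute x (star y)) (k : ℤ) : Commute x (starPow y k) := by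
  obtain ⟨n, rfl | rfl⟩ := k.eq_nat_or_neg
  · rw [starPow_natCast]; exact h.pow_right n
  · rw [starPow_neg_natCast]; exact h'.pow_right n

/-- The adjoint of a unitary is its inverse, so `starPow` is the power in the unitary group and
inherits its exponent law. -/
theorem starPow_coe_unitary [Monoid A] [StarMul A] (u : unitary A) (k : ℤ) :
    starPow (u : A) k = ((u ^ k : unitary A) : A) := by
  obtain ⟨n, rfl | rfl⟩ := k.eq_nat_or_neg
  · rw [starPow_natCast, zpow_natCast]; rfl
  · rw [starPow_neg_natCast, zpow_neg, zpow_natCast, ← inv_pow]; rfl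

theorem starPow_add [Monoid A] [StarMul A] {x : A} (h : x * star x = 1) (h' : star x * x = 1)
    (k l : ℤ) : starPow x (k + l) = starPow x k * starPow x l := by
  have := starPow_coe_unitary (⟨x, h', h⟩ : unitary A)
  simp only at this
  rw [this, this, this, zpow_add]; rfl

end StarPow

/-- The monomial `(star a) ^ r * c ^ k * a ^ s * v ^ l`. -/
def monomial {A : Type*} [Monoid A] [Star A] (a c v : A) (r : ℕ) (k : ℤ) (s : ℕ) (l : ℤ) : A :=
  star a ^ r * starPow c k * a ^ s * starPow v l

theorem map_monomial {A B F : Type*} [Monoid A] [StarMul A] [Monoid B] [StarMul B] [FunLike F A B]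
    [MonoidHomClass F A B] [StarHomClass F A B] (f : F) (a c v : A) (r : ℕ) (k : ℤ) (s : ℕ)
    (l : ℤ) : f (monomial a c v r k s l) = monomial (f a) (f c) (f v) r k s l := by
  simp only [monomial, map_mul, map_pow, map_star, map_starPow]

/-! ### Algebra of the relations of `U_0(2)` -/

namespace URelations

variable {B : Type*} [Ring B] [StarRing B] {a c v : B} (h : URelations a c v)

include h

theorem c_mul_star_a : c * star a = 0 := by
  have := congrArg star h.mul_star
  simpa using this

theorem star_c_mul_star_a : star c * star a = 0 := by rw [← star_mul, h.mul, star_zero]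

theorem star_c_mul_c : star c * c = 1 - star a * a := by rw [← h.add]; abel

theorem c_mul_star_c : c * star c = 1 - star a * a := by rw [h.normal, h.star_c_mul_c]

theorem commute_a (l : ℤ) : Commute a (starPow v l) := commute_starPow h.av h.av_star l

theorem commute_c (l : ℤ) : Commute c (starPow v l) := commute_starPow h.cv h.cv_star l

theorem commute_star_a (l : ℤ) : Commute (star a) (starPow v l) := by
  have := (h.commute_a (-l)).star_star
  rwa [star_starPow, neg_neg] at this

theorem commute_star_c (l : ℤ) : Commute (star c) (starPow v l) := by
  have := (h.commute_c (-l)).star_star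
  rwa [star_starPow, neg_neg] at this

theorem commute_starPow_c (k l : ℤ) : Commute (starPow c k) (starPow v l) :=
  (commute_starPow (h.commute_c l).symm (h.commute_star_c l).symm k).symm

theorem a_mul_starPow {k : ℤ} (hk : k ≠ 0) : a * starPow c k = 0 := by
  obtain ⟨n, rfl | rfl⟩ := k.eq_nat_or_neg <;>
    obtain ⟨n, rfl⟩ := Nat.exists_eq_succ_of_ne_zero (n := n) (by simpa using hk)
  · rw [starPow_natCast, pow_succ', ← mul_assoc, h.mul, zero_mul]
  · rw [starPow_neg_natCast, pow_succ', ← mul_assoc, h.mul_star, zero_mul]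

theorem a_pow_mul_star_a_pow (n : ℕ) : a ^ n * star a ^ n = 1 := by
  induction n with
  | zero => simp
  | succ n ih => rw [pow_succ, pow_succ', mul_assoc, ← mul_assoc a, h.a_star, one_mul, ih]

theorem a_pow_mul_star_a_pow_of_le {m n : ℕ} (hmn : m ≤ n) :
    a ^ m * star a ^ n = star a ^ (n - m) := by
  obtain ⟨d, rfl⟩ := Nat.exists_eq_add_of_le hmn
  rw [pow_add, ← mul_assoc, h.a_pow_mul_star_a_pow, one_mul, Nat.add_sub_cancel_left]

theorem a_pow_mul_star_a_pow_of_ge {m n : ℕ} (hmn : n ≤ m) :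
    a ^ m * star a ^ n = a ^ (m - n) := by
  obtain ⟨d, rfl⟩ := Nat.exists_eq_add_of_le' hmn
  rw [pow_add, mul_assoc, h.a_pow_mul_star_a_pow, mul_one, Nat.add_sub_cancel_right]

/-- The projection `1 - star a * a` acts as the identity on the nonzero powers of `c`. -/
theorem proj_mul_starPow {k : ℤ} (hk : k ≠ 0) : (1 - star a * a) * starPow c k = starPow c k := by
  rw [sub_mul, one_mul, mul_assoc, h.a_mul_starPow hk, mul_zero, sub_zero]

theorem a_mul_proj : a * (1 - star a * a) = 0 := by
  rw [mul_sub, mul_one, ← mul_assoc, h.a_star, one_mul, sub_self]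

theorem proj_mul_star_a : (1 - star a * a) * star a = 0 := by
  rw [sub_mul, one_mul, mul_assoc, h.a_star, mul_one, sub_self]

theorem proj_mul_proj : (1 - star a * a) * (1 - star a * a) = 1 - star a * a := by
  rw [sub_mul, one_mul, mul_assoc, h.a_mul_proj, mul_zero, sub_zero]

/-- Taking adjoints reverses the word and puts the power of `v` in front, from where it commutes to
the end. This reduces negative powers of `c` to positive ones. -/
theorem star_monomial (r : ℕ) (k : ℤ) (s : ℕ) (l : ℤ) :
    star (monomial a c v r k s l) = monomial a c v s (-k) r (-l) := by
  simp only [monomial, star_mul, star_starPow, star_pow, star_star, ← mul_assoc]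
  rw [((h.commute_star_a (-l)).pow_left s).symm.eq, mul_assoc (star a ^ s),
    (h.commute_starPow_c (-k) (-l)).symm.eq, ← mul_assoc, mul_assoc _ _ (a ^ r),
    ((h.commute_a (-l)).pow_left r).symm.eq, ← mul_assoc]

/-- Left multiplication by the generators and their adjoints preserves the span of the
monomials. -/
theorem mul_mem_span [Algebra ℂ B] {W : Submodule ℂ B}
    (hW : W = Submodule.span ℂ {x | ∃ r k s l, x = monomial a c v r k s l}) {x : B} (hx : x ∈ W) :
    a * x ∈ W ∧ star a * x ∈ W ∧ c * x ∈ W ∧ star c * x ∈ W ∧ v * x ∈ W ∧ star v * x ∈ W := by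
  have hmem : ∀ r k s l, monomial a c v r k s l ∈ W := fun r k s l => by
    rw [hW]; exact Submodule.subset_span ⟨r, k, s, l, rfl⟩
  rw [hW] at hx
  induction hx using Submodule.span_induction with
  | zero => simp
  | add x y _ _ hx hy =>
    simp only [mul_add]
    exact ⟨W.add_mem hx.1 hy.1, W.add_mem hx.2.1 hy.2.1, W.add_mem hx.2.2.1 hy.2.2.1,
      W.add_mem hx.2.2.2.1 hy.2.2.2.1, W.add_mem hx.2.2.2.2.1 hy.2.2.2.2.1,
      W.add_mem hx.2.2.2.2.2 hy.2.2.2.2.2⟩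
  | smul z x _ hx =>
    simp only [mul_smul_comm]
    exact ⟨W.smul_mem _ hx.1, W.smul_mem _ hx.2.1, W.smul_mem _ hx.2.2.1,
      W.smul_mem _ hx.2.2.2.1, W.smul_mem _ hx.2.2.2.2.1, W.smul_mem _ hx.2.2.2.2.2⟩
  | mem x hx =>
    obtain ⟨r, k, s, l, rfl⟩ := hx
    have hv : ∀ j : ℤ, starPow v j * monomial a c v r k s l = monomial a c v r k s (j + l) := by
      intro j
      rw [monomial, monomial, starPow_add h.v_star h.star_v]
      simp only [← mul_assoc]
      rw [((h.commute_star_a j).pow_left r).symm.eq, mul_assoc (star a ^ r),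
        (h.commute_starPow_c k j).symm.eq, ← mul_assoc, mul_assoc _ _ (a ^ s),
        ((h.commute_a j).pow_left s).symm.eq, ← mul_assoc]
    -- The products `c c*` and `c* c` both equal `1 - a* a`. It is absorbed by a nonzero power of
    -- `c`; when no such power is left, it expands into a difference of two monomials.
    have hproj : (1 - star a * a) * monomial a c v 0 0 s l ∈ W := by
      have : (1 - star a * a) * monomial a c v 0 0 s l =
          monomial a c v 0 0 s l - monomial a c v 1 0 (s + 1) l := by
        simp only [monomial, starPow_zero, pow_zero, pow_one, pow_succ' a s, mul_one]
        noncomm_ring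
      rw [this]
      exact W.sub_mem (hmem _ _ _ _) (hmem _ _ _ _)
    have hproj' : ∀ j : ℤ, (1 - star a * a) * starPow c j * a ^ s * starPow v l ∈ W := by
      intro j
      rcases eq_or_ne j 0 with rfl | hj
      · simpa [monomial, mul_assoc] using hproj
      · rw [h.proj_mul_starPow hj]
        simpa [monomial] using hmem 0 j s l
    refine ⟨?_, ?_, ?_, ?_, ?_, ?_⟩
    · rcases r with _ | r
      · rcases eq_or_ne k 0 with rfl | hk
        · convert hmem 0 0 (s + 1) l using 1
          simp [monomial, pow_succ', starPow_zero, mul_assoc]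
        · convert W.zero_mem using 1
          simp only [monomial, pow_zero, one_mul, ← mul_assoc, h.a_mul_starPow hk, zero_mul]
      · convert hmem r k s l using 1
        simp only [monomial, pow_succ', ← mul_assoc, h.a_star, one_mul]
    · convert hmem (r + 1) k s l using 1
      simp only [monomial, pow_succ', ← mul_assoc]
    · rcases r with _ | r
      · obtain ⟨n, rfl | rfl⟩ := k.eq_nat_or_neg
        · convert hmem 0 ((n + 1 : ℕ) : ℤ) s l using 1
          simp only [monomial, starPow_natCast, pow_succ', pow_zero, one_mul, ← mul_assoc]
        -- The exponent `-0` has no `c*` to cancel against, so multiplication by `c` raises the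
        -- power instead.
        · rcases n with _ | n
          · convert hmem 0 ((1 : ℕ) : ℤ) s l using 1
            rw [monomial, monomial, starPow_natCast]
            simp [← mul_assoc, starPow_zero]
          · convert hproj' (-(n : ℤ)) using 1
            simp only [monomial, starPow_neg_natCast, pow_succ', pow_zero, one_mul, ← mul_assoc,
              h.c_mul_star_c]
      -- For `r > 0` the product vanishes since `c a* = 0`.
      · convert W.zero_mem using 1
        simp only [monomial, pow_succ', ← mul_assoc, h.c_mul_star_a, zero_mul]
    · rcases r with _ | r
      · obtain ⟨n, rfl | rfl⟩ := k.eq_nat_or_neg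
        · rcases n with _ | n
          · convert hmem 0 (-((1 : ℕ) : ℤ)) s l using 1
            rw [monomial, monomial, starPow_neg_natCast]
            simp [← mul_assoc, starPow_zero]
          · convert hproj' (n : ℤ) using 1
            simp only [monomial, starPow_natCast, pow_succ', pow_zero, one_mul, ← mul_assoc,
              h.star_c_mul_c]
        · convert hmem 0 (-((n + 1 : ℕ) : ℤ)) s l using 1
          simp only [monomial, starPow_neg_natCast, pow_succ', pow_zero, one_mul, ← mul_assoc]
      · convert W.zero_mem using 1
        simp only [monomial, pow_succ', ← mul_assoc, h.star_c_mul_star_a, zero_mul]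
    · have := hv ((1 : ℕ) : ℤ)
      rw [starPow_natCast, pow_one] at this
      rw [this]; exact hmem _ _ _ _
    · have := hv (-((1 : ℕ) : ℤ))
      rw [starPow_neg_natCast, pow_one] at this
      rw [this]; exact hmem _ _ _ _

end URelations

/-! ### Density of the monomials -/

namespace Presentation

variable {X : Type} (R : Presentation X)

/-- A subspace which contains the unit and is invariant under left multiplication by the generators
and their adjoints is dense. -/
theorem dense_of_mul_mem (W : Submodule ℂ R.Univ) (h1 : (1 : R.Univ) ∈ W)
    (hg : ∀ x, ∀ y ∈ W, R.gen x * y ∈ W) (hs : ∀ x, ∀ y ∈ W, star (R.gen x) * y ∈ W) :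
    Dense (W : Set R.Univ) := by
  have hd : DenseRange R.toUniv := CStarCompletion.denseRange_of
  refine hd.mono ?_
  rintro _ ⟨f, rfl⟩
  change R.toUniv f ∈ W
  induction f using FreeStarAlgebra.induction_linear with
  | zero => rw [map_zero]; exact W.zero_mem
  | add f g hf hg => rw [map_add]; exact W.add_mem hf hg
  | mono w z =>
    rw [show FreeStarAlgebra.mono w z = z • FreeStarAlgebra.mono w 1 by
      rw [FreeStarAlgebra.smul_mono, mul_one], map_smul]
    refine W.smul_mem _ ?_
    -- Stripping the leftmost letter of a word leaves a left multiplication by a generator or by its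
    -- adjoint.
    induction w using FreeMonoid.inductionOn' with
    | one => exact (map_one R.toUniv).symm ▸ h1
    | of_mul l w ih =>
      have hm : FreeStarAlgebra.mono (FreeMonoid.of l * w) (1 : ℂ) =
          FreeStarAlgebra.mono (FreeMonoid.of l) 1 * FreeStarAlgebra.mono w 1 := by
        rw [FreeStarAlgebra.mono_mul_mono, mul_one]
      rw [hm, map_mul]
      rcases l with ⟨x, _ | _⟩
      · rw [← FreeStarAlgebra.star_gen, map_star]; exact hs x _ ih
      · exact hg x _ ih

end Presentation

/-- The span of the monomials in the elements `a`, `c` and `v`. -/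
def monomialSpan {A : Type*} [CStarAlgebra A] (a c v : A) : Submodule ℂ A :=
  Submodule.span ℂ {x | ∃ r k s l, x = monomial a c v r k s l}

theorem one_mem_monomialSpan {A : Type*} [CStarAlgebra A] (a c v : A) :
    (1 : A) ∈ monomialSpan a c v :=
  Submodule.subset_span ⟨0, 0, 0, 0, by simp [monomial, starPow_zero]⟩

/-- Allows the results on `U_0(2)` to be used for `SU_0(2)` with `v = 1`. The relation `α α* = 1` is
the sum of the last two relations. -/
theorem SURelations.uRelations {B : Type*} [Ring B] [StarRing B] {α γ : B} (h : SURelations α γ) :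
    URelations α γ 1 where
  av := by simp
  cv := by simp
  normal := h.normal.symm
  mul := h.mul
  mul_star := h.mul_star
  v_star := by simp
  star_v := by simp
  a_star := by rw [← h.add, ← h.sub]; abel
  add := by rw [← h.add]; abel

theorem dense_monomialSpan_u : Dense (monomialSpan ua uc uv : Set CU) := by
  have key := fun x (hx : x ∈ monomialSpan ua uc uv) => uRelations.mul_mem_span rfl hx
  refine uPres.dense_of_mul_mem _ (one_mem_monomialSpan _ _ _) ?_ ?_
  · rintro (_ | _ | _) y hy
    exacts [(key y hy).1, (key y hy).2.2.1, (key y hy).2.2.2.2.1]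
  · rintro (_ | _ | _) y hy
    exacts [(key y hy).2.1, (key y hy).2.2.2.1, (key y hy).2.2.2.2.2]

theorem dense_monomialSpan_su : Dense (monomialSpan suα suγ 1 : Set CSU) := by
  have key := fun x (hx : x ∈ monomialSpan suα suγ 1) => suRelations.uRelations.mul_mem_span rfl hx
  refine suPres.dense_of_mul_mem _ (one_mem_monomialSpan _ _ _) ?_ ?_
  · rintro (_ | _) y hy
    exacts [(key y hy).1, (key y hy).2.2.1]
  · rintro (_ | _) y hy
    exacts [(key y hy).2.1, (key y hy).2.2.2.1]

/-! ### States and their convolution -/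

namespace CStarState

variable {A : Type*} [CStarAlgebra A] (φ : CStarState A)

/-- In a representation where `φ` is a vector state, this is the definition of the adjoint operator.
-/
theorem map_star_apply (x : A) : φ (star x) = star (φ x) := by
  obtain ⟨H, _, _, _, π, ξ, -, h⟩ := φ.exists_vector
  rw [h, h, map_star, ContinuousLinearMap.star_eq_adjoint, ContinuousLinearMap.adjoint_inner_right]
  exact (inner_conj_symm (𝕜 := ℂ) _ _).symm

/-- A consequence of the Cauchy-Schwarz inequality. -/
theorem apply_mul_eq_zero {x : A} (hx : φ (star x * x) = 0) (y : A) : φ (y * x) = 0 := by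
  obtain ⟨H, _, _, _, π, ξ, -, h⟩ := φ.exists_vector
  have h0 : π x ξ = 0 := by
    have h1 := h (star x * x)
    rw [hx, map_mul, map_star, ContinuousLinearMap.star_eq_adjoint] at h1
    change 0 = inner ℂ ξ (ContinuousLinearMap.adjoint (π x) (π x ξ)) at h1
    rw [ContinuousLinearMap.adjoint_inner_right] at h1
    exact inner_self_eq_zero.mp h1.symm
  rw [h, map_mul]
  change inner ℂ ξ (π y (π x ξ)) = 0
  rw [h0, map_zero, inner_zero_right]

theorem apply_star_mul_eq_zero {x : A} (hx : φ (star x * x) = 0) (y : A) : φ (star x * y) = 0 := by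
  have := φ.map_star_apply (star y * x)
  rwa [φ.apply_mul_eq_zero hx, star_zero, star_mul, star_star] at this

/-- Expanding gives `φ ((x - 1)* (x - 1)) = 1 - 1 - 1 + 1 = 0`, so `φ (y (x - 1)) = 0` by
Cauchy-Schwarz. -/
theorem apply_mul_of_apply_eq_one {x : A} (hx : φ x = 1) (hxx : φ (star x * x) = 1) (y : A) :
    φ (y * x) = φ y := by
  have h : φ (star (x - 1) * (x - 1)) = 0 := by
    have : star (x - 1) * (x - 1) = star x * x - star x - x + 1 := by
      rw [star_sub, star_one]; noncomm_ring
    rw [this, map_add, map_sub, map_sub, hxx, φ.map_star_apply, hx, φ.map_one']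
    simp
  have := φ.apply_mul_eq_zero h y
  rw [mul_sub, mul_one, map_sub] at this
  exact sub_eq_zero.mp this

/-- A state with value `1` on a projection `e` lives on the corner of `e`: `e` may be inserted on
the right by the preceding lemma, and on the left by taking adjoints. -/
theorem apply_eq_compress {e : A} (he : star e = e) (hee : e * e = e) (h1 : φ e = 1) (x : A) :
    φ x = φ (e * x * e) := by
  have hxx : φ (star e * e) = 1 := by rw [he, hee, h1]
  rw [φ.apply_mul_of_apply_eq_one h1 hxx]
  have h2 := φ.apply_mul_of_apply_eq_one h1 hxx (star x)
  rw [φ.map_star_apply, ← star_star (star x * e), φ.map_star_apply] at h2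
  rw [star_mul, star_star, he] at h2
  exact (star_injective h2).symm

theorem ext_of_dense {a c v : A} (hd : Dense (monomialSpan a c v : Set A)) {φ ψ : CStarState A}
    (h : ∀ r k s l, φ (monomial a c v r k s l) = ψ (monomial a c v r k s l)) : φ = ψ := by
  refine CStarState.ext fun x => ?_
  have : φ.toCLM = ψ.toCLM := by
    refine ContinuousLinearMap.ext_on hd ?_
    rintro _ ⟨r, k, s, l, rfl⟩
    exact h r k s l
  rw [this]

end CStarState

/-! ### The coproduct on monomials -/

theorem add_pow_of_mul_eq_zero {R : Type*} [Ring R] {x y : R} (h : x * y = 0) (k : ℕ) :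
    (x + y) ^ k = ∑ j ∈ Finset.range (k + 1), y ^ j * x ^ (k - j) := by
  induction k with
  | zero => simp
  | succ k ih =>
    -- A leading `x` kills every term that begins with `y`, so only `j = 0` survives.
    have hx : x * ∑ j ∈ Finset.range (k + 1), y ^ j * x ^ (k - j) = x ^ (k + 1) := by
      rw [Finset.mul_sum, Finset.sum_range_succ', Finset.sum_eq_zero]
      · rw [pow_zero, one_mul, zero_add, Nat.sub_zero, pow_succ']
      · intro j _
        rw [pow_succ', ← mul_assoc, ← mul_assoc, h, zero_mul, zero_mul]
    rw [pow_succ', ih, add_mul, hx, Finset.sum_range_succ' _ (k + 1), Finset.mul_sum, add_comm]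
    congr 1
    · refine Finset.sum_congr rfl fun j _ => ?_
      rw [← mul_assoc, ← pow_succ', Nat.add_sub_add_right]
    · simp

open SpatialTensor

theorem tmul_pow {A B : Type*} [CStarAlgebra A] [CStarAlgebra B] (x : A) (y : B) (n : ℕ) :
    tmul x y ^ n = tmul (x ^ n) (y ^ n) := by
  induction n with
  | zero => simp [tmul_one_one]
  | succ n ih => rw [pow_succ, ih, tmul_mul_tmul, pow_succ, pow_succ]

theorem starPow_tmul {A B : Type*} [CStarAlgebra A] [CStarAlgebra B] (x : A) (y : B) (k : ℤ) :
    starPow (tmul x y) k = tmul (starPow x k) (starPow y k) := by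
  obtain ⟨n, rfl | rfl⟩ := k.eq_nat_or_neg
  · simp only [starPow_natCast, tmul_pow]
  · simp only [starPow_neg_natCast, SpatialTensor.star_tmul, tmul_pow]

/-- A `*`-homomorphism which acts on the generators as the coproduct of `U_0(2)`. -/
structure IsUComul {A : Type*} [CStarAlgebra A] (a c v : A) (Δ : A →⋆ₐ[ℂ] SpatialTensor A A) :
    Prop where
  rel : URelations a c v
  dense : Dense (monomialSpan a c v : Set A)
  map_a : Δ a = tmul a a
  map_c : Δ c = tmul c a + tmul (star a * star v) c
  map_v : Δ v = tmul v v

theorem isUComul_u : IsUComul ua uc uv uComul :=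
  ⟨uRelations, dense_monomialSpan_u, uLift_a _, uLift_c _, uLift_v _⟩

/-- For `v = 1` the coproduct formulas of `U_0(2)` become those of `SU_0(2)`. -/
theorem isUComul_su : IsUComul suα suγ 1 suComul where
  rel := suRelations.uRelations
  dense := dense_monomialSpan_su
  map_a := suLift_α _
  map_c := by rw [star_one, mul_one]; exact suLift_γ _
  map_v := by rw [map_one, tmul_one_one]

namespace IsUComul

variable {A : Type*} [CStarAlgebra A] {a c v : A} {Δ : A →⋆ₐ[ℂ] SpatialTensor A A}
  (h : IsUComul a c v Δ)

include h

theorem map_monomial (r k s : ℕ) (l : ℤ) : Δ (monomial a c v r k s l) =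
    ∑ j ∈ Finset.range (k + 1), tmul (monomial a c v (r + j) ((k - j : ℕ) : ℤ) s (l - j))
      (monomial a c v r j (k - j + s) l) := by
  have hr := h.rel
  -- The second leg contains `a c = 0`; this is what reduces the power of `Δ c` to the terms `y^j
  -- x^(k-j)`.
  have h0 : tmul c a * tmul (star a * star v) c = 0 := by
    rw [tmul_mul_tmul, hr.mul, tmul_zero]
  have hcomm : Commute (star a) (star v) := by
    have := hr.commute_star_a (-((1 : ℕ) : ℤ))
    rwa [starPow_neg_natCast, pow_one] at this
  rw [IdemU02.map_monomial, h.map_a, h.map_c, h.map_v, monomial, starPow_natCast,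
    add_pow_of_mul_eq_zero h0, SpatialTensor.star_tmul, starPow_tmul, Finset.mul_sum,
    Finset.sum_mul, Finset.sum_mul]
  refine Finset.sum_congr rfl fun j hj => ?_
  simp only [tmul_pow, tmul_mul_tmul]
  congr 1
  · rw [monomial, sub_eq_add_neg, add_comm l, starPow_add hr.v_star hr.star_v, starPow_natCast,
      hcomm.mul_pow, ← starPow_neg_natCast v, pow_add]
    -- The factor `v^(-j)` coming from `(a* v*)^j` is moved past the powers of `c` and `a`.
    have h1 := ((hr.commute_c (-(j : ℤ))).pow_left (k - j)).symm.eq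
    have h2 := ((hr.commute_a (-(j : ℤ))).pow_left s).symm.eq
    simp only [mul_assoc]
    rw [← mul_assoc (starPow v _) (c ^ _), h1]
    simp only [mul_assoc]
    rw [← mul_assoc (starPow v _) (a ^ _), h2]
    simp only [mul_assoc]
  · rw [monomial, starPow_natCast, pow_add]
    simp only [mul_assoc]

theorem conv_monomial (φ : CStarState A) (r k s : ℕ) (l : ℤ) :
    φ.conv Δ φ (monomial a c v r k s l) = ∑ j ∈ Finset.range (k + 1),
      φ (monomial a c v (r + j) ((k - j : ℕ) : ℤ) s (l - j)) *
      φ (monomial a c v r j (k - j + s) l) := by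
  change φ.tensor φ (Δ _) = _
  rw [h.map_monomial, map_sum]
  exact Finset.sum_congr rfl fun j _ => CStarState.tensor_tmul _ _ _ _

/-- A monomial without `c` is group-like: the sum has the single term `j = 0`. -/
theorem conv_monomial_zero (φ : CStarState A) (r s : ℕ) (l : ℤ) :
    φ.conv Δ φ (monomial a c v r 0 s l) = φ (monomial a c v r 0 s l) ^ 2 := by
  have := h.conv_monomial φ r 0 s l
  simpa [sq] using this

/-- For `k > 0` every term of the convolution vanishes: for `j = 0` the first factor contains `c^k`,
for `j > 0` the second contains `c^j`. For `k = 0` the convolution squares the value, which fixes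
`0` and `1`. -/
theorem isIdempotent_of_values {φ : CStarState A}
    (h0 : ∀ r k s l, k ≠ 0 → φ (monomial a c v r k s l) = 0)
    (h1 : ∀ r s l, φ (monomial a c v r 0 s l) = 0 ∨ φ (monomial a c v r 0 s l) = 1) :
    φ.IsIdempotent Δ := by
  have hpos : ∀ (r k s : ℕ) (l : ℤ), φ.conv Δ φ (monomial a c v r k s l) =
      φ (monomial a c v r k s l) := by
    intro r k s l
    rcases Nat.eq_zero_or_pos k with rfl | hk
    · rw [Nat.cast_zero, h.conv_monomial_zero]
      rcases h1 r s l with h2 | h2 <;> simp [h2]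
    · rw [h.conv_monomial, h0 r k s l (by simpa using hk.ne'), Finset.sum_eq_zero]
      intro j hj
      rcases Nat.eq_zero_or_pos j with rfl | hj'
      · rw [h0 _ _ _ _ (by simpa using hk.ne'), zero_mul]
      · rw [h0 r j _ _ (by simpa using hj'.ne'), mul_zero]
  refine CStarState.ext_of_dense h.dense fun r k s l => ?_
  obtain ⟨n, rfl | rfl⟩ := k.eq_nat_or_neg
  · exact hpos r n s l
  -- Negative powers of `c` are the adjoints of positive ones.
  · have h2 := congrArg star (hpos s n r (-l))
    rwa [← CStarState.map_star_apply, ← CStarState.map_star_apply, h.rel.star_monomial,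
      neg_neg] at h2

theorem eq_zero_or_one {φ : CStarState A} (hφ : φ.IsIdempotent Δ) (r s : ℕ) (l : ℤ) :
    φ (monomial a c v r 0 s l) = 0 ∨ φ (monomial a c v r 0 s l) = 1 := by
  have h1 := h.conv_monomial_zero φ r s l
  rw [show φ.conv Δ φ = φ from hφ] at h1
  rcases eq_or_ne (φ (monomial a c v r 0 s l)) 0 with h2 | h2
  · exact Or.inl h2
  · refine Or.inr (mul_left_cancel₀ h2 ?_)
    rw [mul_one, ← sq, ← h1]

end IsUComul

/-! ### The states `ψ_n` -/

/-- A source of representations: an isometry `S` and a unitary `U` commuting with it. Then `U` also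
commutes with `S*`, hence with the projection `1 - S S*` onto the kernel of `S*`, on which the image
of `γ` acts as `U`. -/
theorem suRelations_of_isometry {B : Type*} [Ring B] [StarRing B] {S U : B} (hS : star S * S = 1)
    (hU : star U * U = 1) (hU' : U * star U = 1) (hSU : S * U = U * S) :
    SURelations (star S) (U * (1 - S * star S)) := by
  have h1 : star S * U = U * star S := by
    have h := congrArg star hSU
    rw [star_mul, star_mul] at h
    calc star S * U = U * (star U * star S) * U := by rw [← mul_assoc, hU', one_mul]
      _ = U * star S * (star U * U) := by rw [h]; noncomm_ring
      _ = U * star S := by rw [hU, mul_one]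
  have h2 : star S * (1 - S * star S) = 0 := by
    rw [mul_sub, mul_one, ← mul_assoc, hS, one_mul, sub_self]
  have h3 : (1 - S * star S) * (1 - S * star S) = 1 - S * star S := by
    rw [sub_mul, one_mul, mul_assoc, h2, mul_zero, sub_zero]
  have h4 : star (1 - S * star S) = 1 - S * star S := by simp
  have h5 : U * (1 - S * star S) = (1 - S * star S) * U := by
    rw [mul_sub, sub_mul, mul_one, one_mul, mul_assoc, h1, ← mul_assoc, ← hSU, mul_assoc]
  have h6 : star (U * (1 - S * star S)) * (U * (1 - S * star S)) = 1 - S * star S := by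
    rw [star_mul, h4, mul_assoc, ← mul_assoc (star U), hU, one_mul, h3]
  constructor
  · rw [← mul_assoc, h1, mul_assoc, h2, mul_zero]
  · rw [star_mul, h4, ← mul_assoc, h2, zero_mul]
  · rw [h6, h5, star_mul, h4, mul_assoc, ← mul_assoc U, hU', one_mul, h3]
  · rw [h6, star_star, sub_add_cancel]
  · rw [h6, star_star, hS]

/-- The vector state of a unit vector. -/
def vectorState {H : Type*} [NormedAddCommGroup H] [InnerProductSpace ℂ H] [CompleteSpace H]
    (ξ : H) (hξ : ‖ξ‖ = 1) : CStarState (H →L[ℂ] H) where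
  toCLM := (innerSL ℂ ξ).comp (ContinuousLinearMap.apply ℂ H ξ)
  map_one' := by
    change inner ℂ ξ ξ = 1
    rw [inner_self_eq_norm_sq_to_K, hξ]; simp
  nonneg' T := by
    change 0 ≤ inner ℂ ξ (star T (T ξ))
    rw [ContinuousLinearMap.star_eq_adjoint, ContinuousLinearMap.adjoint_inner_right,
      inner_self_eq_norm_sq_to_K]
    have h : (0 : ℂ) ≤ ((‖T ξ‖ ^ 2 : ℝ) : ℂ) := Complex.zero_le_real.mpr (sq_nonneg _)
    rwa [Complex.ofReal_pow] at h

theorem vectorState_apply {H : Type*} [NormedAddCommGroup H] [InnerProductSpace ℂ H]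
    [CompleteSpace H] (ξ : H) (hξ : ‖ξ‖ = 1) (T : H →L[ℂ] H) :
    vectorState ξ hξ T = inner ℂ ξ (T ξ) := rfl

theorem clm_ext_basis {I H : Type*} [NormedAddCommGroup H] [InnerProductSpace ℂ H]
    (b : HilbertBasis I ℂ H) {S T : H →L[ℂ] H} (h : ∀ i, S (b i) = T (b i)) : S = T := by
  refine ContinuousLinearMap.ext_on (s := Set.range b) ?_ ?_
  · exact Submodule.dense_iff_topologicalClosure_eq_top.mpr b.dense_span
  · rintro _ ⟨i, rfl⟩; exact h i

section Shift

variable {I H : Type*} [NormedAddCommGroup H] [InnerProductSpace ℂ H] [CompleteSpace H]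
  (b : HilbertBasis I ℂ H)

/-- The isometry with `b i ↦ b (f i)`. -/
def basisShift {f : I → I} (hf : Function.Injective f) : H →ₗᵢ[ℂ] H :=
  (b.orthonormal.comp f hf).orthogonalFamily.linearIsometry.comp b.repr.toLinearIsometry

theorem basisShift_apply {f : I → I} (hf : Function.Injective f) (i : I) :
    basisShift b hf (b i) = b (f i) := by
  classical
  change (b.orthonormal.comp f hf).orthogonalFamily.linearIsometry (b.repr (b i)) = _
  rw [b.repr_self, OrthogonalFamily.linearIsometry_apply_single]
  simp

/-- The isometry with `b i ↦ b (f i)` as an element of the C*-algebra of bounded operators. -/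
def basisShiftCLM {f : I → I} (hf : Function.Injective f) : H →L[ℂ] H :=
  (basisShift b hf).toContinuousLinearMap

theorem basisShiftCLM_apply {f : I → I} (hf : Function.Injective f) (i : I) :
    basisShiftCLM b hf (b i) = b (f i) := basisShift_apply b hf i

theorem star_basisShiftCLM_mul_self {f : I → I} (hf : Function.Injective f) :
    star (basisShiftCLM b hf) * basisShiftCLM b hf = 1 :=
  (ContinuousLinearMap.norm_map_iff_adjoint_comp_self (basisShiftCLM b hf)).mp
    (basisShift b hf).norm_map

end Shift

/-! ### A representation of `SU_0(2)` by shifts -/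

section Existence

variable {H : Type*} [NormedAddCommGroup H] [InnerProductSpace ℂ H] [CompleteSpace H]
  (b : HilbertBasis (ℕ × ℤ) ℂ H)

theorem injective_shift_fst : Function.Injective fun i : ℕ × ℤ => (i.1 + 1, i.2) := by
  rintro ⟨m, j⟩ ⟨m', j'⟩ h
  simpa using h

theorem injective_shift_snd : Function.Injective fun i : ℕ × ℤ => (i.1, i.2 + 1) := by
  rintro ⟨m, j⟩ ⟨m', j'⟩ h
  simpa using h

/-- The shift in the first index. -/
def shiftFst : H →L[ℂ] H := basisShiftCLM b injective_shift_fst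

/-- The shift in the second index. -/
def shiftSnd : H →L[ℂ] H := basisShiftCLM b injective_shift_snd

/-- The partial isometry with `b (0, j) ↦ b (0, j + 1)` which annihilates the other vectors of the
basis. -/
def shiftGamma : H →L[ℂ] H := shiftSnd b * (1 - shiftFst b * star (shiftFst b))

/-- The second index runs through `ℤ`, so the shift has the backward shift as a right inverse. It
agrees with the left inverse provided by the adjoint of an isometry. -/
theorem shiftSnd_mul_star : shiftSnd b * star (shiftSnd b) = 1 := by
  have hinj : Function.Injective fun i : ℕ × ℤ => (i.1, i.2 - 1) := by
    rintro ⟨m, j⟩ ⟨m', j'⟩ h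
    simpa using h
  have h1 : shiftSnd b * basisShiftCLM b hinj = 1 := by
    refine clm_ext_basis b fun i => ?_
    change basisShiftCLM b injective_shift_snd (basisShiftCLM b hinj (b i)) = b i
    rw [basisShiftCLM_apply, basisShiftCLM_apply]
    simp
  have h2 : star (shiftSnd b) * shiftSnd b = 1 := star_basisShiftCLM_mul_self b _
  have h3 : star (shiftSnd b) = basisShiftCLM b hinj := left_inv_eq_right_inv h2 h1
  rw [h3, h1]

theorem shift_relations : SURelations (star (shiftFst b))
    (shiftGamma b) := by
  refine suRelations_of_isometry (star_basisShiftCLM_mul_self b _)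
    (star_basisShiftCLM_mul_self b _) (shiftSnd_mul_star b) ?_
  refine clm_ext_basis b fun i => ?_
  change basisShiftCLM b injective_shift_fst (basisShiftCLM b injective_shift_snd (b i)) =
    basisShiftCLM b injective_shift_snd (basisShiftCLM b injective_shift_fst (b i))
  simp only [basisShiftCLM_apply]

theorem star_shiftFst_succ (m : ℕ) (j : ℤ) : star (shiftFst b) (b (m + 1, j)) = b (m, j) := by
  have h1 := basisShiftCLM_apply b injective_shift_fst (m, j)
  have h2 := star_basisShiftCLM_mul_self b injective_shift_fst
  have h3 := congrArg (fun T : H →L[ℂ] H => T (b (m, j))) h2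
  change star (shiftFst b) (basisShiftCLM b injective_shift_fst (b (m, j))) = b (m, j) at h3
  rwa [h1] at h3

/-- The range of the shift is spanned by vectors of positive first index, so every coordinate of the
image is `0`. -/
theorem star_shiftFst_zero (j : ℤ) : star (shiftFst b) (b (0, j)) = 0 := by
  have h : b.repr (star (shiftFst b) (b (0, j))) = 0 := by
    ext i
    rw [b.repr_apply_apply, ContinuousLinearMap.star_eq_adjoint,
      ContinuousLinearMap.adjoint_inner_right]
    change inner ℂ (basisShiftCLM b _ (b i)) _ = _
    rw [basisShiftCLM_apply]
    exact b.orthonormal.inner_eq_zero (by simp)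
  exact (LinearIsometryEquiv.map_eq_zero_iff _).mp h

theorem star_shiftFst_pow (n s : ℕ) (j : ℤ) : (star (shiftFst b) ^ s) (b (n, j)) =
    if s ≤ n then b (n - s, j) else 0 := by
  induction s with
  | zero => simp
  | succ s ih =>
    rw [pow_succ']
    change star (shiftFst b) ((star (shiftFst b) ^ s) (b (n, j))) = _
    rw [ih]
    split_ifs with h1 h2 h2
    · obtain ⟨d, rfl⟩ := Nat.exists_eq_add_of_le h2
      rw [show s + 1 + d - s = d + 1 by omega, star_shiftFst_succ,
        show s + 1 + d - (s + 1) = d by omega]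
    -- Here `s = n`: the first index has come down to `0`, and one more step annihilates the vector.
    · rw [show n - s = 0 by omega, star_shiftFst_zero]
    · omega
    · rw [map_zero]

theorem shift_gamma_zero (j : ℤ) :
    (shiftGamma b) (b (0, j)) = b (0, j + 1) := by
  change shiftSnd b (b (0, j) - shiftFst b (star (shiftFst b) (b (0, j)))) = _
  rw [star_shiftFst_zero, map_zero, sub_zero]
  exact basisShiftCLM_apply b _ _

theorem shift_gamma_succ (m : ℕ) (j : ℤ) :
    (shiftGamma b) (b (m + 1, j)) = 0 := by
  change shiftSnd b (b (m + 1, j) - shiftFst b (star (shiftFst b) (b (m + 1, j)))) = _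
  rw [star_shiftFst_succ, show shiftFst b (b (m, j)) = b (m + 1, j) from
    basisShiftCLM_apply b _ _, sub_self, map_zero]

/-- The exponent is `k + 1` because the zeroth power does not annihilate the vectors with `m > 0`.
-/
theorem shift_gamma_pow (m k : ℕ) (j : ℤ) :
    ((shiftGamma b) ^ (k + 1)) (b (m, j)) =
      if m = 0 then b (0, j + (k + 1 : ℕ)) else 0 := by
  induction k generalizing j with
  | zero =>
    rw [zero_add, pow_one]
    rcases m with _ | m
    · simp [shift_gamma_zero]
    · simp [shift_gamma_succ]
  | succ k ih =>
    rw [pow_succ]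
    change (_ ^ (k + 1) : H →L[ℂ] H) (shiftGamma b (b (m, j))) = _
    rcases m with _ | m
    · rw [shift_gamma_zero, ih]
      simp [add_assoc, add_comm]
    · rw [shift_gamma_succ, map_zero]
      simp

/-- With `ξ = b (n, 0)`, the value is the inner product of `α^r ξ` and `γ^k α^s ξ`. Powers of `α`
lower the first index and give `0` beyond `n`. For `k > 0` the operator `γ^k` either annihilates or
changes the second index, so the product is `0`; for `k = 0` orthonormality leaves `r = s ≤ n`. -/
theorem isPsi_vectorState (n : ℕ) :
    IsPsi n ((vectorState (b (n, 0)) (b.orthonormal.1 _)).comp (suLift (shift_relations b))) := by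
  set φ := (vectorState (b (n, 0)) (b.orthonormal.1 _)).comp (suLift (shift_relations b)) with hφ
  have hin : ∀ i j, inner ℂ (b i) (b j) = if i = j then (1 : ℂ) else 0 :=
    fun i j => orthonormal_iff_ite.mp b.orthonormal i j
  have key : ∀ r k s : ℕ, φ (star suα ^ r * starPow suγ k * suα ^ s) =
      if r = s ∧ s ≤ n ∧ (k : ℤ) = 0 then 1 else 0 := by
    intro r k s
    rw [starPow_natCast, hφ, CStarState.comp_apply, vectorState_apply, map_mul, map_mul, map_pow,
      map_pow, map_pow, map_star, suLift_α, suLift_γ, ← star_pow, mul_assoc]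
    change inner ℂ (b (n, 0)) (star (star (shiftFst b) ^ r) ((shiftGamma b ^ k)
      ((star (shiftFst b) ^ s) _))) = _
    rw [ContinuousLinearMap.star_eq_adjoint, ContinuousLinearMap.adjoint_inner_right,
      star_shiftFst_pow, star_shiftFst_pow]
    rcases k with _ | k
    · split_ifs <;> simp [hin] <;> omega
    · rw [if_neg (c := r = s ∧ _) (by simp; omega)]
      split_ifs
      · rw [shift_gamma_pow]
        split_ifs
        · rw [hin, if_neg (by simp; omega)]
        · rw [inner_zero_right]
      · rw [map_zero, inner_zero_right]
      · rw [inner_zero_left]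
      · rw [inner_zero_left]
  intro r s k
  obtain ⟨m, rfl | rfl⟩ := k.eq_nat_or_neg
  · exact key r m s
  · have h := congrArg star (key s m r)
    rw [← CStarState.map_star_apply, star_mul, star_mul, star_pow, star_pow, star_star,
      star_starPow, ← mul_assoc] at h
    rw [h, apply_ite star, star_one, star_zero]
    congr 1
    simp only [neg_eq_zero, eq_iff_iff]
    constructor <;> rintro ⟨rfl, h1, h2⟩ <;> exact ⟨rfl, h1, h2⟩

end Existence

theorem exists_isPsi (n : ℕ) : ∃ ψ : CStarState CSU, IsPsi n ψ :=
  ⟨_, isPsi_vectorState (HilbertBasis.ofRepr (LinearIsometryEquiv.refl ℂ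
    (lp (fun _ : ℕ × ℤ => ℂ) 2))) n⟩

theorem IsPsi.apply_monomial {n : ℕ} {ψ : CStarState CSU} (h : IsPsi n ψ) (r : ℕ) (k : ℤ) (s : ℕ)
    (l : ℤ) : ψ (monomial suα suγ 1 r k s l) = if r = s ∧ s ≤ n ∧ k = 0 then 1 else 0 := by
  rw [monomial, one_starPow, mul_one, h]

theorem IsPsi.unique {n : ℕ} {ψ ψ' : CStarState CSU} (h : IsPsi n ψ) (h' : IsPsi n ψ') : ψ' = ψ :=
  CStarState.ext_of_dense dense_monomialSpan_su fun r k s l => by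
    rw [h.apply_monomial, h'.apply_monomial]

theorem IsPsi.isIdempotent {n : ℕ} {ψ : CStarState CSU} (h : IsPsi n ψ) :
    ψ.IsIdempotent suComul := by
  refine isUComul_su.isIdempotent_of_values (fun r k s l hk => ?_) fun r s l => ?_
  · rw [h.apply_monomial, if_neg fun h0 => hk h0.2.2]
  · rw [h.apply_monomial]
    split_ifs <;> simp

/-! ### Haar states and characters -/

section Haar

open MeasureTheory

variable {G : Type*} [Group G] [TopologicalSpace G] [IsTopologicalGroup G] [CompactSpace G]

/-- The integral of a character over a closed subgroup is `1` or `0`, according to whether or not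
the character is trivial on the subgroup. -/
theorem haarIntegral_character (H : ClosedSubgroup G) (χ : H → ℂ)
    (hχ : ∀ x y, χ (x * y) = χ x * χ y) [Decidable (∀ x, χ x = 1)] :
    haarIntegral H χ = if ∀ x, χ x = 1 then 1 else 0 := by
  let _ : MeasurableSpace H := borel H
  have _ : BorelSpace H := ⟨rfl⟩
  have hprob : IsProbabilityMeasure
      (Measure.haarMeasure (⊤ : TopologicalSpace.PositiveCompacts H)) :=
    ⟨Measure.haarMeasure_self⟩
  change ∫ h, χ h ∂(Measure.haarMeasure (⊤ : TopologicalSpace.PositiveCompacts H)) = _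
  split_ifs with h
  · simp [h]
  · push Not at h
    obtain ⟨y, hy⟩ := h
    -- Translation by `y` multiplies the integral by `χ y ≠ 1` and leaves it unchanged, so it is
    -- `0`.
    have h2 := integral_mul_left_eq_self
      (μ := Measure.haarMeasure (⊤ : TopologicalSpace.PositiveCompacts H)) χ y
    simp_rw [hχ] at h2
    rw [integral_const_mul] at h2
    have h3 : (χ y - 1) * ∫ h, χ h ∂(Measure.haarMeasure
        (⊤ : TopologicalSpace.PositiveCompacts H)) = 0 := by
      rw [sub_mul, h2, one_mul, sub_self]
    exact (mul_eq_zero.mp h3).resolve_left (sub_ne_zero.mpr hy)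

end Haar

theorem star_coe_circle (z : Circle) : star (z : ℂ) = ((z⁻¹ : Circle) : ℂ) :=
  (Circle.coe_inv_eq_conj z).symm

theorem starPow_coe_circle (z : Circle) (l : ℤ) : starPow (z : ℂ) l = ((z ^ l : Circle) : ℂ) := by
  obtain ⟨n, rfl | rfl⟩ := l.eq_nat_or_neg
  · rw [starPow_natCast, zpow_natCast, Circle.coe_pow]
  · rw [starPow_neg_natCast, star_coe_circle, zpow_neg, zpow_natCast, ← inv_pow, Circle.coe_pow]

theorem torusMonomial_mul (i j : ℤ) (w z : Torus) :
    torusMonomial i j (w * z) = torusMonomial i j w * torusMonomial i j z := by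
  rw [torusMonomial, torusMonomial, torusMonomial, ← Circle.coe_mul, Prod.fst_mul, Prod.snd_mul,
    mul_zpow, mul_zpow, mul_mul_mul_comm]

open Classical in
theorem haarIntegral_torusMonomial (H : ClosedSubgroup Torus) (i j : ℤ) :
    haarIntegral H (fun w => torusMonomial i j w) =
      if ∀ w ∈ H, w.1 ^ i * w.2 ^ j = 1 then 1 else 0 := by
  rw [haarIntegral_character H (fun w => torusMonomial i j w)
    (fun x y => torusMonomial_mul i j x y)]
  simp only [torusMonomial, Circle.coe_eq_one, Subtype.forall]

theorem piTorus_monomial_apply (r : ℕ) (k : ℤ) (s : ℕ) (l : ℤ) (w : Torus) :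
    piTorus (monomial ua uc uv r k s l) w = if k = 0 then torusMonomial ((s : ℤ) - r) l w else 0 := by
  -- Point evaluation is a `*`-homomorphism, so the monomial may be computed in `ℂ` with `c`
  -- replaced by `0`.
  change ContinuousMap.evalStarAlgHom ℂ ℂ w (piTorus (monomial ua uc uv r k s l)) = _
  rw [map_monomial, map_monomial, piTorus, uLift_a, uLift_c, uLift_v]
  change monomial (w.1 : ℂ) 0 (w.2 : ℂ) r k s l = _
  split_ifs with hk
  · rw [monomial, hk, starPow_zero, mul_one, star_coe_circle, starPow_coe_circle, torusMonomial,
      ← Circle.coe_pow, ← Circle.coe_pow, ← Circle.coe_mul, ← Circle.coe_mul, inv_pow, sub_eq_neg_add,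
      zpow_add, zpow_neg, zpow_natCast, zpow_natCast]
  · rw [monomial, zero_starPow (star_zero ℂ) hk]; simp

theorem torusState_monomial (H : ClosedSubgroup Torus) (r : ℕ) (k : ℤ) (s : ℕ) (l : ℤ) :
    torusState H (monomial ua uc uv r k s l) =
      if k = 0 then haarIntegral H (fun w => torusMonomial ((s : ℤ) - r) l w) else 0 := by
  change haarIntegral H (fun w => piTorus (monomial ua uc uv r k s l) w) = _
  simp_rw [piTorus_monomial_apply]
  split_ifs with hk
  · rfl
  · simp [haarIntegral]

/-- The values are Haar integrals of characters, hence `0` or `1`, and `c` is sent to `0`. -/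
theorem torusState_isIdempotent (H : ClosedSubgroup Torus) :
    (torusState H).IsIdempotent uComul := by
  classical
  refine isUComul_u.isIdempotent_of_values (fun r k s l hk => ?_) fun r s l => ?_
  · rw [torusState_monomial, if_neg hk]
  · rw [torusState_monomial, if_pos rfl, haarIntegral_torusMonomial]
    split_ifs <;> simp

/-- A character of a C*-algebra as a state. -/
def characterState {A : Type*} [CStarAlgebra A] (χ : A →⋆ₐ[ℂ] ℂ) : CStarState A where
  toCLM := χ.toAlgHom.toLinearMap.mkContinuous 1 fun x => by
    rw [one_mul]; exact NonUnitalStarAlgHom.norm_apply_le χ x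
  map_one' := map_one χ
  nonneg' x := by
    change 0 ≤ χ (star x * x)
    rw [map_mul, map_star]
    exact star_mul_self_nonneg _

theorem torusState_trivialSubgroup : torusState trivialSubgroup = characterState uCounit := by
  classical
  refine CStarState.ext_of_dense dense_monomialSpan_u fun r k s l => ?_
  rw [torusState_monomial]
  change _ = uCounit _
  rw [map_monomial, uCounit, uLift_a, uLift_c, uLift_v, haarIntegral_torusMonomial]
  rw [if_pos (c := ∀ w ∈ trivialSubgroup, _) fun w hw => by
    rw [show w = 1 from hw]
    simp]
  split_ifs with hk
  · simp [monomial, hk, starPow_zero, one_starPow]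
  · rw [monomial, zero_starPow (star_zero ℂ) hk]; simp

/-! ### The states `ψ_n ⊗ φ_m` -/

/-- The generator of the subgroup of `ℤ` which annihilates the closed subgroup of the circle with
index `m`. -/
def circleModulus : WithTop ℕ+ → ℕ
  | none => 0
  | some m => m

theorem forall_zpow_eq_one_iff (m : WithTop ℕ+) (l : ℤ) :
    (∀ z ∈ circleSubgroup m, z ^ l = 1) ↔ (circleModulus m : ℤ) ∣ l := by
  have hpi := Real.pi_pos
  rcases m with _ | m
  · change (∀ z ∈ (⊤ : Subgroup Circle), z ^ l = 1) ↔ ((0 : ℕ) : ℤ) ∣ l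
    simp only [Subgroup.mem_top, true_imp_iff, Nat.cast_zero, zero_dvd_iff]
    constructor
    · intro h
      by_contra hl
      -- The `l`-th power of this point is `exp (iπ)`, which is not `1`.
      have h1 := h (Circle.exp (Real.pi / l))
      have hl' : (l : ℝ) ≠ 0 := by exact_mod_cast hl
      rw [← Circle.exp_intCast_mul, mul_div_cancel₀ _ hl'] at h1
      exact Circle.exp_pi_ne_one h1
    · rintro rfl z
      exact zpow_zero z
  · change (∀ z : Circle, z ^ (m : ℕ) = 1 → z ^ l = 1) ↔ ((m : ℕ) : ℤ) ∣ l
    have hm : ((m : ℕ) : ℝ) ≠ 0 := by exact_mod_cast m.ne_zero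
    constructor
    · intro h
      -- A primitive `m`-th root of unity suffices to detect divisibility by `m`.
      have h1 := h (Circle.exp (2 * Real.pi / (m : ℕ))) (by
        rw [← Circle.exp_natCast_mul, mul_div_cancel₀ _ hm, Circle.exp_two_pi])
      rw [← Circle.exp_intCast_mul, Circle.exp_eq_one] at h1
      obtain ⟨n, hn⟩ := h1
      refine ⟨n, ?_⟩
      have h2 : (l : ℝ) = (m : ℕ) * n := by
        field_simp at hn
        linarith
      exact_mod_cast h2
    · rintro ⟨n, rfl⟩ z hz
      rw [zpow_mul, zpow_natCast, hz, one_zpow]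

theorem circleState_starPow (m : WithTop ℕ+) (l : ℤ) :
    circleState m (starPow circleCoord l) = if (circleModulus m : ℤ) ∣ l then 1 else 0 := by
  classical
  have h0 : ∀ z : Circle, starPow circleCoord l z = ((z ^ l : Circle) : ℂ) := fun z => by
    change ContinuousMap.evalStarAlgHom ℂ ℂ z (starPow circleCoord l) = _
    rw [map_starPow, ← starPow_coe_circle]; rfl
  change haarIntegral (circleSubgroup m) (fun z => starPow circleCoord l z) = _
  simp_rw [h0]
  rw [haarIntegral_character (circleSubgroup m) (fun z => (((z : Circle) ^ l : Circle) : ℂ))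
    (fun x y => by rw [← Circle.coe_mul, ← mul_zpow]; rfl)]
  simp only [Circle.coe_eq_one, Subtype.forall, forall_zpow_eq_one_iff]

open SpatialTensor in
theorem prodState_monomial (ψ : CStarState CSU) (m : WithTop ℕ+) (r : ℕ) (k : ℤ) (s : ℕ) (l : ℤ) :
    prodState ψ m (monomial ua uc uv r k s l) =
      ψ (star suα ^ r * starPow suγ k * suα ^ s) * if (circleModulus m : ℤ) ∣ l then 1 else 0 := by
  rw [prodState, CStarState.comp_apply, map_monomial, split, uLift_a, uLift_c, uLift_v, monomial,
    SpatialTensor.star_tmul, starPow_tmul, starPow_tmul, tmul_pow, tmul_pow, star_one, one_starPow,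
    one_starPow, one_pow, one_pow, tmul_mul_tmul, tmul_mul_tmul, tmul_mul_tmul,
    CStarState.tensor_tmul, mul_one, mul_one, mul_one, one_mul, circleState_starPow]

theorem IsPsi.prodState_monomial {n : ℕ} {ψ : CStarState CSU} (h : IsPsi n ψ) (m : WithTop ℕ+)
    (r : ℕ) (k : ℤ) (s : ℕ) (l : ℤ) : prodState ψ m (monomial ua uc uv r k s l) =
      if (r = s ∧ s ≤ n ∧ k = 0) ∧ (circleModulus m : ℤ) ∣ l then 1 else 0 := by
  rw [IdemU02.prodState_monomial, h, ite_zero_mul_ite_zero, one_mul]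

theorem IsPsi.prodState_isIdempotent {n : ℕ} {ψ : CStarState CSU} (h : IsPsi n ψ)
    (m : WithTop ℕ+) : (prodState ψ m).IsIdempotent uComul := by
  refine isUComul_u.isIdempotent_of_values (fun r k s l hk => ?_) fun r s l => ?_
  · rw [h.prodState_monomial, if_neg fun h0 => hk h0.1.2.2]
  · rw [h.prodState_monomial]
    split_ifs <;> simp

/-! ### Duality for closed subgroups of the torus -/

/-- An injective homomorphism from `ℚ / ℤ` to the circle. -/
theorem exists_injective_addChar_rat :
    ∃ E : AddChar (AddCircle (1 : ℚ)) Circle, ∀ x, E x = 1 → x = 0 := by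
  let f : AddCircle (1 : ℚ) →+ AddCircle (1 : ℝ) :=
    QuotientAddGroup.lift (AddSubgroup.zmultiples (1 : ℚ))
      ((QuotientAddGroup.mk' (AddSubgroup.zmultiples (1 : ℝ))).comp
        (Rat.castHom ℝ).toAddMonoidHom) (by
      rintro _ ⟨n, rfl⟩
      refine (AddCircle.coe_eq_zero_iff (1 : ℝ)).mpr ⟨n, ?_⟩
      simp)
  refine ⟨⟨fun x => AddCircle.toCircle (f x), by simp, fun x y => by
    rw [map_add, AddCircle.toCircle_add]⟩, fun x hx => ?_⟩
  have h1 : f x = 0 := by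
    refine AddCircle.injective_toCircle one_ne_zero ?_
    rw [AddCircle.toCircle_zero]
    exact hx
  induction x using QuotientAddGroup.induction_on with
  | H q =>
    obtain ⟨n, hn⟩ := (AddCircle.coe_eq_zero_iff (1 : ℝ)).mp
      (show ((q : ℝ) : AddCircle (1 : ℝ)) = 0 from h1)
    refine (AddCircle.coe_eq_zero_iff (1 : ℚ)).mpr ⟨n, ?_⟩
    rw [zsmul_eq_mul, mul_one] at hn ⊢
    exact_mod_cast hn

/-- The annihilator in the torus of a group of characters. -/
def annihilator (Γ : AddSubgroup (ℤ × ℤ)) : ClosedSubgroup Torus where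
  carrier := {w | ∀ g ∈ Γ, w.1 ^ g.1 * w.2 ^ g.2 = 1}
  mul_mem' {x y} hx hy g hg := by
    rw [Prod.fst_mul, Prod.snd_mul, mul_zpow, mul_zpow, mul_mul_mul_comm, hx g hg, hy g hg,
      one_mul]
  one_mem' g _ := by simp
  inv_mem' {x} hx g hg := by
    rw [Prod.fst_inv, Prod.snd_inv, inv_zpow, inv_zpow, ← mul_inv, hx g hg, inv_one]
  isClosed' := by
    simp only [Set.ofPred_forall]
    refine isClosed_iInter fun g => isClosed_iInter fun _ => isClosed_eq ?_ continuous_const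
    exact (continuous_fst.zpow _).mul (continuous_snd.zpow _)

/-- The double annihilator of `Γ` is `Γ`. A pair outside `Γ` has a nonzero class in the quotient,
which some homomorphism to `ℚ / ℤ` does not annihilate. Composed with an embedding of `ℚ / ℤ` in the
circle, it is a character of `ℤ × ℤ`, that is, a point of the torus, trivial on `Γ` but not on the
pair. -/
theorem forall_mem_annihilator_iff (Γ : AddSubgroup (ℤ × ℤ)) (i j : ℤ) :
    (∀ w ∈ annihilator Γ, w.1 ^ i * w.2 ^ j = 1) ↔ (i, j) ∈ Γ := by
  refine ⟨fun h => ?_, fun h w hw => hw (i, j) h⟩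
  by_contra hij
  obtain ⟨E, hE⟩ := exists_injective_addChar_rat
  obtain ⟨χ, hχ⟩ := CharacterModule.exists_character_apply_ne_zero_of_ne_zero
    (a := (QuotientAddGroup.mk (i, j) : (ℤ × ℤ) ⧸ Γ))
    (fun h0 => hij ((QuotientAddGroup.eq_zero_iff _).mp h0))
  let G : AddChar (ℤ × ℤ) Circle :=
    ⟨fun x => E (χ (QuotientAddGroup.mk x)), by simp, fun x y => by
      rw [QuotientAddGroup.mk_add, map_add, AddChar.map_add_eq_mul]⟩
  -- A character of `ℤ × ℤ` is given by its values on the two basis vectors, the coordinates of the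
  -- required point of the torus.
  have hG : ∀ x : ℤ × ℤ, G (1, 0) ^ x.1 * G (0, 1) ^ x.2 = G x := by
    intro x
    rw [← AddChar.map_zsmul_eq_zpow, ← AddChar.map_zsmul_eq_zpow, ← AddChar.map_add_eq_mul]
    congr 1
    ext <;> simp
  have h1 := h (G (1, 0), G (0, 1)) (fun x hx => by
    rw [hG]
    change E (χ (QuotientAddGroup.mk x)) = 1
    rw [(QuotientAddGroup.eq_zero_iff x).mpr hx, map_zero, AddChar.map_zero_eq_one])
  rw [hG (i, j)] at h1
  exact hχ (hE _ h1)

/-! ### Classification of the idempotent states -/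

namespace IsUComul

variable {A : Type*} [CStarAlgebra A] {a c v : A} {Δ : A →⋆ₐ[ℂ] SpatialTensor A A}

/-- If a state annihilates the ideal generated by `c`, its values on the monomials are determined by
a function on `ℤ × ℤ`. -/
theorem exists_fourier (h : IsUComul a c v Δ) {φ : CStarState A}
    (hφ : ∀ r, φ (star a ^ r * a ^ r) = 1) :
    (∀ r k s l, k ≠ 0 → φ (monomial a c v r k s l) = 0) ∧
    ∃ F : ℤ → ℤ → ℂ, ∀ (r s : ℕ) (l : ℤ), φ (monomial a c v r 0 s l) = F ((s : ℤ) - r) l := by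
  have hr := h.rel
  -- The two consecutive projections `a*^r a^r` and `a*^(r+1) a^(r+1)` have the same value, so `φ`
  -- vanishes on their difference; Cauchy-Schwarz does the rest.
  have hP : ∀ (r : ℕ) (y : A), φ (star a ^ r * (1 - star a * a) * y) = 0 := by
    intro r y
    have h1 : star a ^ r * (1 - star a * a) = star ((1 - star a * a) * a ^ r) := by
      simp
    rw [h1]
    refine φ.apply_star_mul_eq_zero ?_ y
    rw [← h1, mul_assoc, ← mul_assoc (1 - star a * a), hr.proj_mul_proj]
    have h2 : star a ^ r * ((1 - star a * a) * a ^ r) =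
        star a ^ r * a ^ r - star a ^ (r + 1) * a ^ (r + 1) := by
      rw [pow_succ (star a), pow_succ' a]; noncomm_ring
    rw [h2, map_sub, hφ, hφ, sub_self]
  have hstep : ∀ r s l, φ (monomial a c v (r + 1) 0 (s + 1) l) = φ (monomial a c v r 0 s l) := by
    intro r s l
    have h1 := hP r (a ^ s * starPow v l)
    have h2 : star a ^ r * (1 - star a * a) * (a ^ s * starPow v l) =
        monomial a c v r 0 s l - monomial a c v (r + 1) 0 (s + 1) l := by
      simp only [monomial, starPow_zero, pow_succ (star a), pow_succ' a s]
      noncomm_ring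
    rw [h2, map_sub] at h1
    exact (sub_eq_zero.mp h1).symm
  have hstep' : ∀ d r s l, φ (monomial a c v (r + d) 0 (s + d) l) = φ (monomial a c v r 0 s l) := by
    intro d r s l
    induction d with
    | zero => rfl
    | succ d ih => rw [← add_assoc, ← add_assoc, hstep, ih]
  refine ⟨fun r k s l hk => ?_,
    -- The representative of the difference `i = s - r` in which one of the two exponents is `0`.
    fun i l => φ (monomial a c v (-i).toNat 0 i.toNat l), fun r s l => ?_⟩
  -- A nonzero power of `c` absorbs `1 - a* a`, which `φ` does not see.
  · rw [monomial, ← hr.proj_mul_starPow hk]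
    simpa only [mul_assoc] using hP r (starPow c k * a ^ s * starPow v l)
  · rcases le_total r s with hrs | hrs
    · obtain ⟨d, rfl⟩ := Nat.exists_eq_add_of_le' hrs
      have h1 := hstep' r 0 d l
      rw [zero_add] at h1
      have h2 : (-(((d + r : ℕ) : ℤ) - r)).toNat = 0 := by omega
      have h3 : (((d + r : ℕ) : ℤ) - r).toNat = d := by omega
      simp only [h1, h2, h3]
    · obtain ⟨d, rfl⟩ := Nat.exists_eq_add_of_le' hrs
      have h1 := hstep' s d 0 l
      rw [zero_add] at h1
      have h2 : (-((s : ℤ) - (d + s : ℕ))).toNat = d := by omega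
      have h3 : ((s : ℤ) - (d + s : ℕ)).toNat = 0 := by omega
      simp only [h1, h2, h3]

/-- The Fourier coefficients of an idempotent state which annihilates the ideal generated by `c`
are the indicator function of a subgroup. -/
theorem exists_subgroup (h : IsUComul a c v Δ) {φ : CStarState A} (hi : φ.IsIdempotent Δ)
    (hφ : ∀ r, φ (star a ^ r * a ^ r) = 1) :
    ∃ Γ : AddSubgroup (ℤ × ℤ), ∀ (r s : ℕ) (l : ℤ),
      (((s : ℤ) - r, l) ∈ Γ → φ (monomial a c v r 0 s l) = 1) ∧
      (((s : ℤ) - r, l) ∉ Γ → φ (monomial a c v r 0 s l) = 0) := by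
  have hr := h.rel
  obtain ⟨-, F, hF⟩ := h.exists_fourier hφ
  have hF' : ∀ (i l : ℤ) (d : ℕ), F i l = φ (monomial a c v ((-i).toNat + d) 0 (i.toNat + d) l) := by
    intro i l d
    rw [hF]
    congr 1
    omega
  let Γ : AddSubgroup (ℤ × ℤ) :=
    { carrier := {x | F x.1 x.2 = 1}
      zero_mem' := by
        have := hF 0 0 0
        simp only [monomial, pow_zero, starPow_zero, mul_one, Nat.cast_zero, sub_zero] at this
        exact this.symm.trans φ.map_one'
      add_mem' := by
        rintro ⟨i, l⟩ ⟨i', l'⟩ hx hy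
        have hx' : F i l = 1 := hx
        have hy' : F i' l' = 1 := hy
        change F (i + i') (l + l') = 1
        set s := i.toNat with hs
        set r := (-i).toNat with hrr
        -- Both exponents of the second monomial are raised by `s`, which does not change their
        -- difference, so that `a^s a*^(r')` reduces to a power of `a*`.
        set s' := i'.toNat + s with hs'
        set r' := (-i').toNat + s with hr'
        have h1 : φ (monomial a c v r' 0 s' l') = 1 := by rw [← hF', hy']
        have h2 : φ (star (monomial a c v r' 0 s' l') * monomial a c v r' 0 s' l') = 1 := by
          have h3 : star (monomial a c v r' 0 s' l') * monomial a c v r' 0 s' l' =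
              star a ^ s' * a ^ s' := by
            have h4 : starPow v (-l') * starPow v l' = 1 := by
              rw [← starPow_add hr.v_star hr.star_v, neg_add_cancel, starPow_zero]
            rw [hr.star_monomial, monomial, monomial, neg_zero, starPow_zero, mul_one, mul_one]
            calc star a ^ s' * a ^ r' * starPow v (-l') * (star a ^ r' * a ^ s' * starPow v l')
                = star a ^ s' * a ^ r' * (starPow v (-l') * (star a ^ r' * a ^ s')) *
                    starPow v l' := by noncomm_ring
              _ = star a ^ s' * (a ^ r' * star a ^ r') * a ^ s' *
                    (starPow v (-l') * starPow v l') := by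
                  rw [(((hr.commute_star_a (-l')).pow_left r').mul_left
                    ((hr.commute_a (-l')).pow_left s')).symm.eq]
                  noncomm_ring
              _ = _ := by rw [hr.a_pow_mul_star_a_pow, h4, mul_one, mul_one]
          rw [h3, hφ]
        -- The second factor has `φ m = φ (m* m) = 1` and can be cancelled on the right.
        have h5 := φ.apply_mul_of_apply_eq_one h1 h2 (monomial a c v r 0 s l)
        have h6 : monomial a c v r 0 s l * monomial a c v r' 0 s' l' =
            monomial a c v (r + (r' - s)) 0 s' (l + l') := by
          simp only [monomial, starPow_zero, mul_one]
          calc star a ^ r * a ^ s * starPow v l * (star a ^ r' * a ^ s' * starPow v l')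
              = star a ^ r * a ^ s * (starPow v l * (star a ^ r' * a ^ s')) * starPow v l' := by
                noncomm_ring
            _ = star a ^ r * (a ^ s * star a ^ r') * a ^ s' * (starPow v l * starPow v l') := by
                rw [(((hr.commute_star_a l).pow_left r').mul_left
                  ((hr.commute_a l).pow_left s')).symm.eq]
                noncomm_ring
            _ = _ := by
                rw [hr.a_pow_mul_star_a_pow_of_le (by omega), ← starPow_add hr.v_star hr.star_v,
                  pow_add _ r]
        rw [h6, hF, hF] at h5
        rw [show i + i' = (s' : ℤ) - (r + (r' - s) : ℕ) by omega, h5,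
          show (s : ℤ) - r = i by omega, hx']
      neg_mem' := by
        rintro ⟨i, l⟩ hx
        have hx' : F i l = 1 := hx
        change F (-i) (-l) = 1
        have h1 := congrArg star (hF' i l 0)
        rw [← CStarState.map_star_apply, hr.star_monomial, hx', star_one, neg_zero, hF] at h1
        rw [h1]
        congr 1
        omega }
  refine ⟨Γ, fun r s l => ⟨fun hm => (hF r s l).trans hm, fun hm => ?_⟩⟩
  -- Idempotence enters only here, to exclude values other than `0` and `1`.
  refine (h.eq_zero_or_one hi r s l).resolve_right fun h1 => hm ?_
  rwa [hF] at h1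

/-- The values of a state on the subgroup generated by `v`, if they are `0` or `1`. -/
theorem exists_modulus (h : IsUComul a c v Δ) {φ : CStarState A} (hi : φ.IsIdempotent Δ) :
    ∃ d : ℕ, ∀ l : ℤ, φ (starPow v l) = if (d : ℤ) ∣ l then 1 else 0 := by
  have hr := h.rel
  have hmon : ∀ l, monomial a c v 0 0 0 l = starPow v l := fun l => by
    simp [monomial, starPow_zero]
  let Γ : AddSubgroup ℤ :=
    { carrier := {l | φ (starPow v l) = 1}
      zero_mem' := by
        change φ (starPow v 0) = 1
        rw [starPow_zero, φ.map_one']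
      add_mem' := by
        intro k l hk hl
        change φ (starPow v (k + l)) = 1
        rw [starPow_add hr.v_star hr.star_v, φ.apply_mul_of_apply_eq_one hl, hk]
        rw [star_starPow, ← starPow_add hr.v_star hr.star_v, neg_add_cancel, starPow_zero,
          φ.map_one']
      neg_mem' := by
        intro l hl
        change φ (starPow v (-l)) = 1
        rw [← star_starPow, φ.map_star_apply, show φ (starPow v l) = 1 from hl, star_one] }
  -- The generator may be `0`, which later corresponds to `m = ∞`.
  obtain ⟨g, hg⟩ := Int.subgroup_cyclic Γ
  refine ⟨g.natAbs, fun l => ?_⟩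
  have hl : (g.natAbs : ℤ) ∣ l ↔ l ∈ Γ := by
    rw [hg, AddSubgroup.mem_closure_singleton, Int.natAbs_dvd]
    constructor
    · rintro ⟨n, rfl⟩; exact ⟨n, by simp [mul_comm]⟩
    · rintro ⟨n, rfl⟩; exact ⟨n, by simp [mul_comm]⟩
  split_ifs with hd
  · exact hl.mp hd
  · rw [← hmon]
    refine (h.eq_zero_or_one hi 0 0 l).resolve_right fun h1 => hd (hl.mpr ?_)
    rwa [hmon] at h1

/-- The values of an idempotent state which does not annihilate the ideal generated by `c`. -/
theorem values_of_jump (h : IsUComul a c v Δ) {φ : CStarState A} (hi : φ.IsIdempotent Δ) {n : ℕ}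
    (hn : φ (star a ^ n * a ^ n) = 1) (hn' : φ (star a ^ (n + 1) * a ^ (n + 1)) = 0)
    (r : ℕ) (k : ℤ) (s : ℕ) (l : ℤ) : φ (monomial a c v r k s l) =
      if r = s ∧ s ≤ n ∧ k = 0 then φ (starPow v l) else 0 := by
  have hr := h.rel
  set p := 1 - star a * a with hp
  have hap : a * p = 0 := hr.a_mul_proj
  have hpa : p * star a = 0 := hr.proj_mul_star_a
  have hpp : p * p = p := hr.proj_mul_proj
  have hps : star p = p := by simp [hp]
  -- The difference of the two projections between which the values jump; `φ e = 1`, so `φ` may be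
  -- compressed by `e`.
  set e := star a ^ n * p * a ^ n with he
  have hpow : ∀ m, 0 < m → p * star a ^ m = 0 := by
    intro m hm
    obtain ⟨m, rfl⟩ := Nat.exists_eq_add_of_le' hm
    rw [pow_succ', ← mul_assoc, hpa, zero_mul]
  have hpow' : ∀ m, 0 < m → a ^ m * p = 0 := by
    intro m hm
    obtain ⟨m, rfl⟩ := Nat.exists_eq_add_of_le' hm
    rw [pow_succ, mul_assoc, hap, mul_zero]
  have hes : star e = e := by
    simp [he, hps, mul_assoc]
  have hee : e * e = e := by
    calc e * e = star a ^ n * p * (a ^ n * star a ^ n) * p * a ^ n := by rw [he]; noncomm_ring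
      _ = star a ^ n * (p * p) * a ^ n := by rw [hr.a_pow_mul_star_a_pow]; noncomm_ring
      _ = e := by rw [hpp]
  have he1 : φ e = 1 := by
    have h2 : e = star a ^ n * a ^ n - star a ^ (n + 1) * a ^ (n + 1) := by
      rw [he, hp, pow_succ (star a), pow_succ' a]; noncomm_ring
    rw [h2, map_sub, hn, hn', sub_zero]
  have hcomp := φ.apply_eq_compress hes hee he1
  have hev : ∀ l, Commute e (starPow v l) := fun l =>
    ((((hr.commute_star_a l).pow_left n).mul_left ((Commute.one_left _).sub_left
      ((hr.commute_star_a l).mul_left (hr.commute_a l)))).mul_left ((hr.commute_a l).pow_left n))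
  have hmid : ∀ (r : ℕ) (k : ℤ) (s : ℕ) (l : ℤ), φ (monomial a c v r k s l) =
      φ (star a ^ n * (p * (a ^ n * star a ^ r) * starPow c k * (a ^ s * star a ^ n) * p) * a ^ n *
        starPow v l) := by
    intro r k s l
    rw [hcomp, monomial, mul_assoc, mul_assoc (_ * _) (starPow v l), (hev l).symm.eq, he]
    congr 1
    noncomm_ring
  -- For `m < n` a positive power of `a` remains and kills `c^k`; for `m > n` a positive power of
  -- `a*` remains and is killed by `p`.
  have hleft : ∀ (m : ℕ) (k : ℤ), k ≠ 0 → m ≠ n → p * (a ^ n * star a ^ m) * starPow c k = 0 := by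
    intro m k hk hm
    rcases lt_or_gt_of_ne hm with hm | hm
    · rw [hr.a_pow_mul_star_a_pow_of_ge hm.le]
      obtain ⟨d, rfl⟩ := Nat.exists_eq_add_of_lt hm
      rw [show m + d + 1 - m = d + 1 by omega, pow_succ, mul_assoc, mul_assoc, hr.a_mul_starPow hk,
        mul_zero, mul_zero]
    · rw [hr.a_pow_mul_star_a_pow_of_le hm.le, hpow _ (by omega), zero_mul]
  have hright : ∀ (m : ℕ) (k : ℤ), k ≠ 0 → m ≠ n →
      starPow c k * (a ^ m * star a ^ n) * p = 0 := by
    intro m k hk hm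
    have h1 := congrArg star (hleft m (-k) (neg_ne_zero.mpr hk) hm)
    simpa [star_starPow, hps, mul_assoc] using h1
  have hleft' : ∀ m, n < m → p * (a ^ n * star a ^ m) = 0 := fun m hm => by
    rw [hr.a_pow_mul_star_a_pow_of_le hm.le, hpow _ (by omega)]
  have hne : ∀ (m : ℕ) (k : ℤ) (m' : ℕ) (l : ℤ), m ≠ m' → φ (monomial a c v m k m' l) = 0 := by
    intro m k m' l hmm
    suffices h0 : p * (a ^ n * star a ^ m) * starPow c k * (a ^ m' * star a ^ n) * p = 0 by
      rw [hmid, h0, mul_zero, zero_mul, zero_mul, map_zero]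
    rcases eq_or_ne k 0 with rfl | hk
    · rw [starPow_zero, mul_one]
      rcases lt_or_ge n m with h1 | h1
      · rw [hleft' m h1, zero_mul, zero_mul]
      rcases lt_or_ge n m' with h2 | h2
      · rw [hr.a_pow_mul_star_a_pow_of_ge h2.le, mul_assoc, hpow' _ (by omega), mul_zero]
      -- With both exponents at most `n`, a nonzero power of `a` or of `a*` is left between two
      -- copies of `p`.
      rw [hr.a_pow_mul_star_a_pow_of_ge h1, hr.a_pow_mul_star_a_pow_of_le h2, mul_assoc p]
      rcases lt_or_gt_of_ne hmm with h3 | h3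
      · rw [hr.a_pow_mul_star_a_pow_of_ge (by omega), mul_assoc, hpow' _ (by omega), mul_zero]
      · rw [hr.a_pow_mul_star_a_pow_of_le (by omega), hpow _ (by omega), zero_mul]
    · rcases eq_or_ne m n with rfl | hm
      · rw [mul_assoc _ (starPow c k), mul_assoc, hright m' k hk hmm.symm, mul_zero]
      · rw [hleft m k hk hm, zero_mul, zero_mul]
  -- Compression gives nothing here, as `p c^k p = c^k`. In the convolution sum, however, every term
  -- has a factor with unequal exponents: `n` and `k + n` in the second for `j = 0`, `n + j` and `n`
  -- in the first for `j > 0`.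
  have hpos : ∀ (k : ℕ) (l : ℤ), k ≠ 0 → φ (monomial a c v n k n l) = 0 := by
    intro k l hk
    rw [← show φ.conv Δ φ = φ from hi, h.conv_monomial, Finset.sum_eq_zero]
    intro j _
    rcases Nat.eq_zero_or_pos j with rfl | hj
    · rw [hne n _ _ _ (by omega), mul_zero]
    · rw [hne _ _ _ _ (by omega), zero_mul]
  have hoff : ∀ (m : ℕ) (k l : ℤ), k ≠ 0 → φ (monomial a c v m k m l) = 0 := by
    intro m k l hk
    rcases eq_or_ne m n with rfl | hm
    · obtain ⟨j, rfl | rfl⟩ := k.eq_nat_or_neg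
      · exact hpos j l (by simpa using hk)
      · have h1 := congrArg star (hpos j (-l) (by simpa using hk))
        rwa [← CStarState.map_star_apply, hr.star_monomial, neg_neg, star_zero] at h1
    · rw [hmid, hleft m k hk hm, zero_mul, zero_mul, mul_zero, zero_mul, zero_mul, map_zero]
  -- The value does not depend on `m`, and for `m = 0` it is `φ (v^l)`.
  have hdiag : ∀ (m : ℕ) (l : ℤ), m ≤ n → φ (monomial a c v m 0 m l) = φ (e * starPow v l) := by
    intro m l hm
    rw [hmid, hr.a_pow_mul_star_a_pow_of_ge hm, hr.a_pow_mul_star_a_pow_of_le hm, starPow_zero,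
      mul_one, mul_assoc p, hr.a_pow_mul_star_a_pow, mul_one, hpp, he]
  rcases ne_or_eq r s with hrs | rfl
  · rw [hne r k s l hrs, if_neg fun h0 => hrs h0.1]
  rcases ne_or_eq k 0 with hk | rfl
  · rw [hoff r k l hk, if_neg fun h0 => hk h0.2.2]
  rcases le_or_gt r n with hrn | hrn
  · rw [if_pos ⟨rfl, hrn, rfl⟩, hdiag r l hrn, ← hdiag 0 l (Nat.zero_le n)]
    simp [monomial, starPow_zero]
  · rw [if_neg (by omega), hmid, hleft' r hrn, zero_mul, zero_mul, zero_mul, mul_zero, zero_mul,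
      zero_mul, map_zero]

end IsUComul

/-- Every idempotent state on `C(U_0(2))` belongs to one of the two families. -/
theorem eq_torusState_or_eq_prodState {φ : CStarState CU} (hi : φ.IsIdempotent uComul) {ψ : ℕ → CStarState CSU}
    (hψ : ∀ n, IsPsi n (ψ n)) : (∃ H : ClosedSubgroup Torus, φ = torusState H) ∨
      ∃ (n : ℕ) (m : WithTop ℕ+), φ = prodState (ψ n) m := by
  classical
  have h := isUComul_u
  have hmon : ∀ r, monomial ua uc uv r 0 r 0 = star ua ^ r * ua ^ r := fun r => by
    simp [monomial, starPow_zero]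
  -- Either the projections `a*^r a^r` all have value `1`, or there is a first one with value `0`.
  by_cases hall : ∀ r, φ (star ua ^ r * ua ^ r) = 1
  · left
    obtain ⟨Γ, hΓ⟩ := h.exists_subgroup hi hall
    refine ⟨annihilator Γ, CStarState.ext_of_dense h.dense fun r k s l => ?_⟩
    rw [torusState_monomial]
    split_ifs with hk
    · rw [hk, haarIntegral_torusMonomial, forall_mem_annihilator_iff]
      split_ifs with hm
      · exact (hΓ r s l).1 hm
      · exact (hΓ r s l).2 hm
    · exact (h.exists_fourier hall).1 r k s l hk
  · right
    push Not at hall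
    have hspec := Nat.find_spec hall
    have hmin := fun m => Nat.find_min hall (m := m)
    -- The first failure is not at `r = 0`, where the value is `φ 1 = 1`.
    obtain ⟨n, hn⟩ : ∃ n, Nat.find hall = n + 1 := by
      refine Nat.exists_eq_succ_of_ne_zero fun h0 => ?_
      rw [h0] at hspec
      exact hspec (by simpa using φ.map_one')
    rw [hn] at hspec
    have h0 : φ (star ua ^ (n + 1) * ua ^ (n + 1)) = 0 := by
      rw [← hmon] at hspec ⊢
      exact (h.eq_zero_or_one hi _ _ _).resolve_right hspec
    have h1 : φ (star ua ^ n * ua ^ n) = 1 := not_not.mp (hmin n (by omega))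
    obtain ⟨d, hd⟩ := h.exists_modulus hi
    obtain ⟨m, rfl⟩ : ∃ m, circleModulus m = d := by
      rcases Nat.eq_zero_or_pos d with rfl | hpos
      · exact ⟨none, rfl⟩
      · exact ⟨some ⟨d, hpos⟩, rfl⟩
    refine ⟨n, m, CStarState.ext_of_dense h.dense fun r k s l => ?_⟩
    rw [h.values_of_jump hi h1 h0, (hψ n).prodState_monomial, hd]
    simp only [← ite_and]

end IdemU02

end

/-! ### The theorem -/

theorem theorem6p4 :
    ∃ ψ : ℕ → CStarState CSU,
      -- for every `n` there is exactly one state `ψ n` with the prescribed values; it is idempotent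
      (∀ n, IsPsi n (ψ n) ∧ (∀ ψ', IsPsi n ψ' → ψ' = ψ n) ∧ (ψ n).IsIdempotent suComul) ∧
      -- the values of the states which are induced by Haar measures
      (∀ (H : ClosedSubgroup Torus) (r s : ℕ) (k l : ℤ),
        torusState H (star ua ^ r * starPow uc k * ua ^ s * starPow uv l) =
          if k = 0 then haarIntegral H (fun w => torusMonomial ((s : ℤ) - r) l w) else 0) ∧
      (∀ x, torusState trivialSubgroup x = uCounit x) ∧
      -- the complete list of the idempotent states
      (∀ φ : CStarState CU, φ.IsIdempotent uComul ↔
        (∃ H : ClosedSubgroup Torus, φ = torusState H) ∨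
        (∃ (n : ℕ) (m : WithTop ℕ+), φ = prodState (ψ n) m)) := by
  choose ψ hψ using exists_isPsi
  refine ⟨ψ, fun n => ⟨hψ n, fun ψ' h' => (hψ n).unique h', (hψ n).isIdempotent⟩,
    fun H r s k l => torusState_monomial H r k s l, fun x => ?_,
    fun φ => ⟨fun hi => eq_torusState_or_eq_prodState hi hψ, ?_⟩⟩
  · rw [torusState_trivialSubgroup]
    rfl
  · rintro (⟨H, rfl⟩ | ⟨n, m, rfl⟩)
    · exact torusState_isIdempotent H
    · exact (hψ n).prodState_isIdempotent m
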